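/- Let $T$ be an unrooted tree (a finite connected acyclic graph) with $n\ge 1$ nodes whose edges are labeled by letters from an integer alphabet $\Sigma=\{0,\dots,\sigma-1\}$ of size $\sigma$ polynomial in $n$. Let $L(T)\subseteq\Sigma^*$ be the set of all words obtained by concatenating the labels along the simple paths of $T$, read from any node to any node (the empty path included). The set $\mathrm{MAW}(T)$ of minimal absent words of $T$ consists of all words $aub$ with $a,b\in\Sigma$ and $u\in\Sigma^*$ such that $au\in L(T)$ and $ub\in L(T)$ but $aub\notin L(T)$. There is a deterministic algorithm on the word RAM with $\Omega(\log n)$-bit words that, given $n$ and the list of the labeled edges of $T$ (in any order), outputs every element of $\mathrm{MAW}(T)$ exactly once in time $O(n^2+|\mathrm{MAW}(T)|)$, using $O(n^2)$ words of space in addition to the write-only output. Here a word $aub\in\mathrm{MAW}(T)$ is output in constant space as a triple $(x,y,b)$, where $x,y$ are nodes of $T$ such that the simple path from $x$ to $y$ spells $au$. Precisely: there is one program $P$ such that for every polynomial $q$ with coefficients in $\mathbb{N}$ there is a constant $C$ such that, for every such tree with $\sigma\le q(n)$ and every word length $w\ge C(\lfloor\log_2 n\rfloor+1)$, the program $P$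 on the $w$-bit word RAM produces such an output in at most $C(n^2+|\mathrm{MAW}(T)|)$ steps, using at most $Cn^2$ memory cells. -/

import Mathlib

/-! ### The word RAM

Words are bit vectors of a fixed width `w`; arithmetic is modulo `2 ^ w`. The machine has
registers, a random access memory whose addresses are words, and a write-only output stream.
A program is a fixed finite text: it cannot depend on the input or on `w`. Every elementary
instruction and every evaluation of a test costs one step. -/

namespace WordRAM

/-- The unit-cost binary operations on words (all comparisons and divisions are unsigned). -/
inductive Op where
  | add | sub | mul | div | mod | and | or | xor | shl | shr

/-- The value of an operation on two `w`-bit words. -/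
def Op.eval {w : ℕ} : Op → BitVec w → BitVec w → BitVec w
  | .add, x, y => x + y
  | .sub, x, y => x - y
  | .mul, x, y => x * y
  | .div, x, y => x / y
  | .mod, x, y => x % y
  | .and, x, y => x &&& y
  | .or, x, y => x ||| y
  | .xor, x, y => x ^^^ y
  | .shl, x, y => x <<< y
  | .shr, x, y => x >>> y

/-- The comparisons by which control flow can branch. -/
inductive Cmp where
  | eq | ne | lt | le

/-- The truth value of a comparison of two `w`-bit words. -/
def Cmp.Holds {w : ℕ} : Cmp → BitVec w → BitVec w → Prop
  | .eq, x, y => x = y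
  | .ne, x, y => x ≠ y
  | .lt, x, y => x.toNat < y.toNat
  | .le, x, y => x.toNat ≤ y.toNat

/-- Word RAM programs. Registers are named by natural numbers; a program names finitely many. -/
inductive Prog where
  /-- do nothing -/
  | skip : Prog
  /-- `r := k` -/
  | const (r k : ℕ) : Prog
  /-- `r := x o y` -/
  | op (o : Op) (r x y : ℕ) : Prog
  /-- `r := memory[x]` -/
  | load (r x : ℕ) : Prog
  /-- `memory[x] := y` -/
  | store (x y : ℕ) : Prog
  /-- append the content of register `x` to the output stream -/
  | output (x : ℕ) : Prog
  /-- run one program after the other -/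
  | seq (p q : Prog) : Prog
  /-- branch on a comparison of the registers `x` and `y` -/
  | ite (c : Cmp) (x y : ℕ) (p q : Prog) : Prog
  /-- loop as long as the comparison of the registers `x` and `y` holds -/
  | loop (c : Cmp) (x y : ℕ) (p : Prog) : Prog

/-- A configuration of the machine with `w`-bit words. -/
@[ext]
structure State (w : ℕ) where
  /-- contents of the registers -/
  reg : ℕ → BitVec w
  /-- contents of the memory cells -/
  mem : ℕ → BitVec w
  /-- everything written to the output stream so far, in order -/
  out : List (BitVec w)

/-- `Exec S p s t s'`: on a machine with `S` memory cells (with addresses `0, …, S - 1`), program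
`p` started in `s` terminates in `s'` after exactly `t` steps. An access to an address outside the
memory has no rule, so a terminating run accesses only the `S` cells. -/
inductive Exec {w : ℕ} (S : ℕ) : Prog → State w → ℕ → State w → Prop
  | skip (s : State w) : Exec S .skip s 1 s
  | const (r k : ℕ) (s : State w) :
      Exec S (.const r k) s 1 { s with reg := Function.update s.reg r (BitVec.ofNat w k) }
  | op (o : Op) (r x y : ℕ) (s : State w) :
      Exec S (.op o r x y) s 1
        { s with reg := Function.update s.reg r (o.eval (s.reg x) (s.reg y)) }
  | load (r x : ℕ) (s : State w) (h : (s.reg x).toNat < S) :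
      Exec S (.load r x) s 1 { s with reg := Function.update s.reg r (s.mem (s.reg x).toNat) }
  | store (x y : ℕ) (s : State w) (h : (s.reg x).toNat < S) :
      Exec S (.store x y) s 1 { s with mem := Function.update s.mem (s.reg x).toNat (s.reg y) }
  | output (x : ℕ) (s : State w) :
      Exec S (.output x) s 1 { s with out := s.out ++ [s.reg x] }
  | seq {p q : Prog} {s s₁ s₂ : State w} {t₁ t₂ : ℕ} (hp : Exec S p s t₁ s₁)
      (hq : Exec S q s₁ t₂ s₂) : Exec S (.seq p q) s (t₁ + t₂) s₂
  | ite_true {c : Cmp} {x y : ℕ} {p q : Prog} {s s' : State w} {t : ℕ}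
      (h : c.Holds (s.reg x) (s.reg y)) (hp : Exec S p s t s') :
      Exec S (.ite c x y p q) s (1 + t) s'
  | ite_false {c : Cmp} {x y : ℕ} {p q : Prog} {s s' : State w} {t : ℕ}
      (h : ¬ c.Holds (s.reg x) (s.reg y)) (hq : Exec S q s t s') :
      Exec S (.ite c x y p q) s (1 + t) s'
  | loop_true {c : Cmp} {x y : ℕ} {p : Prog} {s s₁ s₂ : State w} {t₁ t₂ : ℕ}
      (h : c.Holds (s.reg x) (s.reg y)) (hp : Exec S p s t₁ s₁)
      (hw : Exec S (.loop c x y p) s₁ t₂ s₂) :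
      Exec S (.loop c x y p) s (1 + t₁ + t₂) s₂
  | loop_false {c : Cmp} {x y : ℕ} {p : Prog} {s : State w}
      (h : ¬ c.Holds (s.reg x) (s.reg y)) : Exec S (.loop c x y p) s 1 s

/-- The initial configuration: the input stands at the beginning of the memory, one number per
cell; all other cells and all registers hold zero; nothing has been output. -/
def State.init (w : ℕ) (input : List ℕ) : State w where
  reg _ := 0
  mem i := BitVec.ofNat w (input.getD i 0)
  out := []

end WordRAM

/-! ### Minimal absent words -/

/-- The minimal absent words of a language `L` that is closed under taking factors: the words
`a u b`, with `a` and `b` letters, such that `a u` and `u b` but not `a u b` belong to `L`. -/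
def minimalAbsentWords {α : Type*} (L : Language α) : Set (List α) :=
  {z | ∃ (a : α) (u : List α) (b : α),
    z = a :: (u ++ [b]) ∧ a :: (u ++ [b]) ∉ L ∧ a :: u ∈ L ∧ u ++ [b] ∈ L}

/-- An unrooted tree with nodes `0, …, n - 1` and edges labeled by letters from the integer
alphabet `{0, …, σ - 1}`. -/
structure UnrootedTree (n σ : ℕ) where
  /-- the underlying graph -/
  graph : SimpleGraph (Fin n)
  isTree : graph.IsTree
  /-- the letter on an edge -/
  label : graph.edgeSet → Fin σ

namespace UnrootedTree

variable {n σ : ℕ} (T : UnrootedTree n σ)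

/-- The concatenation of the labels along a walk. -/
def walkWord : {x y : Fin n} → T.graph.Walk x y → List (Fin σ)
  | _, _, .nil => []
  | _, _, .cons h p => T.label ⟨s(_, _), h⟩ :: walkWord p

/-- The language `L(T)`: all words that are read along simple paths, from any node. -/
def language : Language (Fin σ) :=
  {z | ∃ (x y : Fin n) (p : T.graph.Walk x y), p.IsPath ∧ T.walkWord p = z}

/-- The set `MAW(T)`. -/
def maw : Set (List (Fin σ)) :=
  minimalAbsentWords T.language

/-- The simple path from `x` to `y`. -/
noncomputable def path (x y : Fin n) : T.graph.Walk x y :=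
  (T.isTree.existsUnique_path x y).choose

theorem path_isPath (x y : Fin n) : (T.path x y).IsPath :=
  (T.isTree.existsUnique_path x y).choose_spec.1

theorem eq_path {x y : Fin n} {p : T.graph.Walk x y} (hp : p.IsPath) : p = T.path x y :=
  (T.isTree.existsUnique_path x y).choose_spec.2 p hp

theorem length_walkWord {x y : Fin n} (p : T.graph.Walk x y) :
    (T.walkWord p).length = p.length := by
  induction p with
  | nil => rfl
  | cons h p ih => simp [walkWord, ih]

/-- `MAW(T)` is finite, so that its cardinality is `T.maw.ncard`. -/
theorem finite_maw : T.maw.Finite := by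
  refine (List.finite_length_le (Fin σ) (n + 1)).subset ?_
  rintro z ⟨a, u, b, rfl, -, ⟨x, y, p, hp, hu⟩, -⟩
  have h := hp.length_lt
  rw [← T.length_walkWord p, hu] at h
  simp only [Fintype.card_fin, List.length_cons] at h
  simp only [Set.mem_ofPred_eq, List.length_cons, List.length_append, List.length_nil]
  omega

/-- `es` lists every edge of the tree exactly once, in any order and each with any orientation. -/
def IsEdgeList (es : List T.graph.Dart) : Prop :=
  (es.map SimpleGraph.Dart.edge).Nodup ∧ ∀ e ∈ T.graph.edgeSet, e ∈ es.map SimpleGraph.Dart.edge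

/-- The input of the algorithm: the number of nodes, and then for every edge its two ends and its
label. -/
def encode (es : List T.graph.Dart) : List ℕ :=
  n :: es.flatMap fun d => [d.fst.val, d.snd.val, (T.label ⟨d.edge, d.edge_mem⟩).val]

/-- The word described by a triple `(x, y, b)` of two nodes and a letter: the word read along the
simple path from `x` to `y`, followed by `b`. -/
noncomputable def tripleWord (t : Fin n × Fin n × Fin σ) : List (Fin σ) :=
  T.walkWord (T.path t.1 t.2.1) ++ [t.2.2]

/-- The output stream is a sequence of triples of machine words that describes every minimal
absent word of `T` exactly once, and nothing else. -/
def ListsMAW {w : ℕ} (out : List (BitVec w)) : Prop :=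
  ∃ ts : List (Fin n × Fin n × Fin σ),
    out = ts.flatMap (fun t =>
      [BitVec.ofNat w t.1, BitVec.ofNat w t.2.1, BitVec.ofNat w t.2.2]) ∧
    (ts.map T.tripleWord).Nodup ∧
    ∀ z, z ∈ ts.map T.tripleWord ↔ z ∈ T.maw

end UnrootedTree

/-! The words of $L(T)$ form a trie with at most $n^2$ nodes: the language is closed under prefixes,
and every word is spelled by one of the $n^2$ ordered pairs of nodes (`PairClasses.le_mul`). The
trie is built in order of its node numbers. Each trie node keeps the linked list of all pairs
$(x,y)$ whose path spells its word. To process a node, each of its pairs $(x,y)$ is extended by the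
edges at $y$. A neighbour $z$ of $y$ either prolongs the path or lies on it (`extends_or_extends`),
and in the second case $(x,z)$ has been classified already, so the test "not yet classified" selects
the true extensions. The total work is $\sum_{(x,y)}(1+\deg y)=O(n^2)$, since a tree has $n-1$ edges
(`sum_visitTime_le`).

Three devices keep each step at constant cost. A letter is replaced by its rank, the least number of
an edge that carries it; ranks are smaller than $n$ and are found by linear search in $O(n^2)$ time
altogether. The table `child` from ranks to children is never cleared: the children of the current
trie node $v$ get consecutive numbers from `start v` on, so an entry is current exactly if it is at
least `start v` (`TrieNodes.addChild`). The second node $f$ of every path is stored, so that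
deleting the first letter of the word of $(x,y)$ leads to the pair $(f,y)$ and to its trie node.

For the report, let $v$ be a trie node with word $au$, and let $u$ also denote the node of the word
$u$. Then $aub$ is a minimal absent word exactly if $u$, but not $v$, has a child with letter $b$
(`TrieReady.isAbsent_iff`). The letters at $v$ are stamped with the number $v$, and the children of
$u$ are scanned. An unstamped child yields an output; the stamped ones inject into the children of
$v$ (`TrieReady.card_marked_le`). As every trie node is a child at most once, the scans take
$O(n^2+|\mathrm{MAW}(T)|)$ time. A word $aub$ determines $v$ and $b$, hence is reported once.

The program is written in a small language with arrays whose weakest preconditions carry the elapsed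
time as a component of the state. `Cmd.code_exec` transfers what is proved there to the compiled
machine code, with the exact number of steps. -/

/-! ### A structured language on top of the word RAM

Programs are written with named variables and named arrays of natural numbers. They are compiled
to the word RAM; a weakest precondition calculus that also tracks the running time is sound for the
compiled programs. -/

namespace WordRAM

set_option linter.constructorNameAsVariable false

/-- The variables of the structured language. -/
inductive Var where
  | n | i | j | x | y | z | p | q | e | b | c | k | v | m
  deriving DecidableEq

/-- The arrays of the structured language. -/
inductive Arr where
  | adjHead | adjNext | adjNode | adjRank | cls | next | head | first | start | letter | child | mark
  deriving DecidableEq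

/-- The number of a variable. -/
def Var.idx : Var → ℕ
  | .n => 0 | .i => 1 | .j => 2 | .x => 3 | .y => 4 | .z => 5 | .p => 6 | .q => 7 | .e => 8
  | .b => 9 | .c => 10 | .k => 11 | .v => 12 | .m => 13

/-- The number of an array. -/
def Arr.idx : Arr → ℕ
  | .adjHead => 0 | .adjNext => 1 | .adjNode => 2 | .adjRank => 3 | .cls => 4 | .next => 5
  | .head => 6 | .first => 7 | .start => 8 | .letter => 9 | .child => 10 | .mark => 11

theorem Var.idx_injective : Function.Injective Var.idx := by
  intro a b h
  cases a <;> cases b <;> first | rfl | exact absurd h (by decide)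

theorem Arr.idx_injective : Function.Injective Arr.idx := by
  intro a b h
  cases a <;> cases b <;> first | rfl | exact absurd h (by decide)

theorem Arr.idx_lt (a : Arr) : a.idx < 16 := by
  cases a <;> decide

/-- Arithmetic operations on natural numbers. -/
inductive NatOp where
  | add | sub | mul | div | mod

/-- The machine operation that implements an arithmetic operation. -/
def NatOp.op : NatOp → Op
  | .add => .add | .sub => .sub | .mul => .mul | .div => .div | .mod => .mod

/-- The value of an arithmetic operation. -/
def NatOp.eval : NatOp → ℕ → ℕ → ℕ
  | .add, x, y => x + y
  | .sub, x, y => x - y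
  | .mul, x, y => x * y
  | .div, x, y => x / y
  | .mod, x, y => x % y

/-- An operation on numbers below `B` is carried out without overflow. -/
def NatOp.Safe (B : ℕ) : NatOp → ℕ → ℕ → Prop
  | .add, x, y => x + y < B
  | .sub, x, y => y ≤ x
  | .mul, x, y => x * y < B
  | .div, _, _ => True
  | .mod, _, _ => True

theorem NatOp.toNat_eval {w B : ℕ} (hB : B ≤ 2 ^ w) (o : NatOp) (x y : BitVec w)
    (h : o.Safe B x.toNat y.toNat) : (o.op.eval x y).toNat = o.eval x.toNat y.toNat := by
  cases o <;> simp only [NatOp.op, Op.eval, NatOp.eval, NatOp.Safe] at *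
  · rw [BitVec.toNat_add, Nat.mod_eq_of_lt (by omega)]
  · exact BitVec.toNat_sub_of_le (by simpa [BitVec.le_def] using h)
  · rw [BitVec.toNat_mul, Nat.mod_eq_of_lt (by omega)]
  · exact BitVec.toNat_udiv
  · exact BitVec.toNat_umod

/-- Expressions. -/
inductive Expr where
  | var (a : Var)
  | lit (k : ℕ)
  | bin (o : NatOp) (a b : Expr)
  | inp (a : Expr)
  | get (A : Arr) (a : Expr)

/-- The state of a structured program: variables, arrays, output and elapsed time. -/
structure Env where
  var : Var → ℕ
  arr : Arr → ℕ → ℕ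
  out : List ℕ
  time : ℕ

/-- The constant data of a run: the input, its length, the length of the arrays and a bound for
the results of arithmetic. -/
structure Ctx where
  inp : ℕ → ℕ
  base : ℕ
  len : ℕ
  bound : ℕ

/-- Assign a variable. -/
def Env.set (s : Env) (a : Var) (v : ℕ) : Env :=
  { s with var := Function.update s.var a v }

/-- Assign an array cell. -/
def Env.put (s : Env) (A : Arr) (i v : ℕ) : Env :=
  { s with arr := Function.update s.arr A (Function.update (s.arr A) i v) }

/-- Append a number to the output. -/
def Env.emit (s : Env) (v : ℕ) : Env :=
  { s with out := s.out ++ [v] }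

/-- Let time pass. -/
def Env.tick (s : Env) (t : ℕ) : Env :=
  { s with time := s.time + t }

section EnvLemmas

variable (s : Env) (a : Var) (A : Arr) (i v t : ℕ)

@[simp] theorem Env.set_var : (s.set a v).var = Function.update s.var a v := rfl
@[simp] theorem Env.set_arr : (s.set a v).arr = s.arr := rfl
@[simp] theorem Env.set_out : (s.set a v).out = s.out := rfl
@[simp] theorem Env.set_time : (s.set a v).time = s.time := rfl
@[simp] theorem Env.put_var : (s.put A i v).var = s.var := rfl
@[simp] theorem Env.put_arr :
    (s.put A i v).arr = Function.update s.arr A (Function.update (s.arr A) i v) := rfl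
@[simp] theorem Env.put_out : (s.put A i v).out = s.out := rfl
@[simp] theorem Env.put_time : (s.put A i v).time = s.time := rfl
@[simp] theorem Env.emit_var : (s.emit v).var = s.var := rfl
@[simp] theorem Env.emit_arr : (s.emit v).arr = s.arr := rfl
@[simp] theorem Env.emit_out : (s.emit v).out = s.out ++ [v] := rfl
@[simp] theorem Env.emit_time : (s.emit v).time = s.time := rfl
@[simp] theorem Env.tick_var : (s.tick t).var = s.var := rfl
@[simp] theorem Env.tick_arr : (s.tick t).arr = s.arr := rfl
@[simp] theorem Env.tick_out : (s.tick t).out = s.out := rfl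
@[simp] theorem Env.tick_time : (s.tick t).time = s.time + t := rfl

@[simp] theorem Env.tick_tick (t' : ℕ) : (s.tick t).tick t' = s.tick (t + t') := by
  simp [Env.tick, add_assoc]

@[simp] theorem Env.tick_set : (s.tick t).set a v = (s.set a v).tick t := rfl
@[simp] theorem Env.tick_put : (s.tick t).put A i v = (s.put A i v).tick t := rfl
@[simp] theorem Env.tick_emit : (s.tick t).emit v = (s.emit v).tick t := rfl

@[simp] theorem Env.set_set (v' : ℕ) : (s.set a v).set a v' = s.set a v' := by
  simp [Env.set]

end EnvLemmas

namespace Expr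

/-- The value of an expression. -/
def eval (Γ : Ctx) (s : Env) : Expr → ℕ
  | var a => s.var a
  | lit k => k
  | bin o a b => o.eval (a.eval Γ s) (b.eval Γ s)
  | inp a => Γ.inp (a.eval Γ s)
  | get A a => s.arr A (a.eval Γ s)

/-- An expression is evaluated without overflow and without leaving the bounds of the arrays. -/
def Ok (Γ : Ctx) (s : Env) : Expr → Prop
  | var _ => True
  | lit k => k < Γ.bound
  | bin o a b => a.Ok Γ s ∧ b.Ok Γ s ∧ o.Safe Γ.bound (a.eval Γ s) (b.eval Γ s)
  | inp a => a.Ok Γ s ∧ a.eval Γ s < Γ.base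
  | get _ a => a.Ok Γ s ∧ a.eval Γ s < Γ.len

/-- The number of steps taken by the evaluation of an expression. -/
def cost : Expr → ℕ
  | var _ => 1
  | lit _ => 1
  | bin _ a b => a.cost + (b.cost + 1)
  | inp a => a.cost + 1
  | get _ a => a.cost + 6

/-- The machine code that turns an index in register `2 * d + 1` into an address of array `A`. -/
def addrCode (A : Arr) (d : ℕ) : Prog :=
  .seq (.const (2 * d + 3) 16) (.seq (.op .mul (2 * d + 1) (2 * d + 1) (2 * d + 3))
    (.seq (.const (2 * d + 3) A.idx) (.seq (.op .add (2 * d + 1) (2 * d + 1) (2 * d + 3))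
      (.op .add (2 * d + 1) (2 * d + 1) 1))))

/-- The machine code that evaluates an expression into register `2 * d + 1`. -/
def code : Expr → ℕ → Prog
  | var a, d => .op .or (2 * d + 1) (2 * a.idx) (2 * a.idx)
  | lit k, d => .const (2 * d + 1) k
  | bin o a b, d =>
    .seq (a.code d) (.seq (b.code (d + 1)) (.op o.op (2 * d + 1) (2 * d + 1) (2 * d + 3)))
  | inp a, d => .seq (a.code d) (.load (2 * d + 1) (2 * d + 1))
  | get A a, d => .seq (a.code d) (.seq (addrCode A d) (.load (2 * d + 1) (2 * d + 1)))

end Expr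

/-! ### Simulation of expressions by machine code -/

/-- The machine state `σ` represents the state `s` of a structured program. -/
structure Rep {w : ℕ} (Γ : Ctx) (σ : State w) (s : Env) : Prop where
  base : (σ.reg 1).toNat = Γ.base
  var : ∀ a : Var, (σ.reg (2 * a.idx)).toNat = s.var a
  inp : ∀ i < Γ.base, (σ.mem i).toNat = Γ.inp i
  arr : ∀ A : Arr, ∀ i < Γ.len, (σ.mem (16 * i + A.idx + Γ.base)).toNat = s.arr A i
  out : σ.out = s.out.map (BitVec.ofNat w)

/-- The word length suffices for the addresses and the results of arithmetic. -/
structure Ctx.Fits (Γ : Ctx) (w : ℕ) : Prop where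
  len : Γ.base + 16 * Γ.len < 2 ^ w
  bound : Γ.bound ≤ 2 ^ w

variable {w : ℕ} {Γ : Ctx} {σ : State w} {s : Env}

/-- Variables live in the even registers and register 1 holds the base address of the arrays. The
odd registers from 3 on serve as an evaluation stack, which the represented state does not see. -/
theorem Rep.updateReg (h : Rep Γ σ s) {d : ℕ} (hd : 1 ≤ d) (v : BitVec w) :
    Rep Γ { σ with reg := Function.update σ.reg (2 * d + 1) v } s where
  base := by simpa [Function.update_apply, show d ≠ 0 by omega] using h.base
  var a := by
    simpa [Function.update_apply, show 2 * a.idx ≠ 2 * d + 1 by omega] using h.var a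
  inp := h.inp
  arr := h.arr
  out := h.out

theorem Rep.tick (h : Rep Γ σ s) (t : ℕ) : Rep Γ σ (s.tick t) where
  base := h.base
  var := h.var
  inp := h.inp
  arr := h.arr
  out := h.out

theorem Rep.set (h : Rep Γ σ s) (a : Var) (v : BitVec w) :
    Rep Γ { σ with reg := Function.update σ.reg (2 * a.idx) v } (s.set a v.toNat) where
  base := by simpa [Function.update_apply, show 1 ≠ 2 * a.idx by omega] using h.base
  var b := by
    by_cases hb : b = a
    · subst hb; simp
    · have : 2 * b.idx ≠ 2 * a.idx := fun hh => hb (Var.idx_injective (by omega))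
      simpa [Function.update_apply, this, hb] using h.var b
  inp := h.inp
  arr := h.arr
  out := h.out

/-- The arrays are interleaved with stride 16 behind the input. Array numbers are below 16, so
distinct cells have distinct addresses, and none of them meets the input. -/
theorem Rep.put (h : Rep Γ σ s) (A : Arr) (i : ℕ) (v : BitVec w) :
    Rep Γ { σ with mem := Function.update σ.mem (16 * i + A.idx + Γ.base) v }
      (s.put A i v.toNat) where
  base := h.base
  var := h.var
  inp j hj := by
    simpa [Function.update_apply, show j ≠ 16 * i + A.idx + Γ.base by omega] using h.inp j hj
  arr A' j hj := by
    have h1 := A.idx_lt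
    have h2 := A'.idx_lt
    by_cases hA : A' = A
    · subst hA
      by_cases hij : j = i
      · subst hij; simp
      · simpa [Function.update_apply, hij] using h.arr A' j hj
    · have : A'.idx ≠ A.idx := fun hh => hA (Arr.idx_injective hh)
      have h3 : 16 * j + A'.idx ≠ 16 * i + A.idx := by omega
      simpa [Function.update_apply, h3, hA] using h.arr A' j hj
  out := h.out

theorem Rep.emit (h : Rep Γ σ s) (v : BitVec w) :
    Rep Γ { σ with out := σ.out ++ [v] } (s.emit v.toNat) where
  base := h.base
  var := h.var
  inp := h.inp
  arr := h.arr
  out := by simp [h.out]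

/-- The registers below `2 * d` of two machine states agree on the temporary values. -/
def SameTemps (d : ℕ) (σ σ' : State w) : Prop :=
  ∀ d', 1 ≤ d' → d' < d → σ'.reg (2 * d' + 1) = σ.reg (2 * d' + 1)

theorem Expr.addrCode_exec (hΓ : Γ.Fits w) (h : Rep Γ σ s) (A : Arr) {d : ℕ} (hd : 1 ≤ d)
    (hi : (σ.reg (2 * d + 1)).toNat < Γ.len) :
    ∃ σ' : State w, Exec (Γ.base + 16 * Γ.len) (addrCode A d) σ 5 σ' ∧ Rep Γ σ' s ∧
      (σ'.reg (2 * d + 1)).toNat = 16 * (σ.reg (2 * d + 1)).toNat + A.idx + Γ.base ∧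
      SameTemps d σ σ' ∧ σ'.mem = σ.mem := by
  have hA := A.idx_lt
  have hl := hΓ.len
  refine ⟨_, .seq (t₁ := 1) (t₂ := 4) (.const _ _ _) (.seq (t₁ := 1) (t₂ := 3) (.op _ _ _ _ _)
    (.seq (t₁ := 1) (t₂ := 2) (.const _ _ _) (.seq (t₁ := 1) (t₂ := 1) (.op _ _ _ _ _)
      (.op _ _ _ _ _)))), ?_, ?_, ?_, rfl⟩
  · exact ((((h.updateReg (d := d + 1) (by omega) _).updateReg hd _).updateReg (d := d + 1)
      (by omega) _).updateReg hd _).updateReg hd _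
  · have e1 : (2 * d + 3 = 2 * d + 1) = False := by simp
    have e2 : (1 = 2 * d + 1) = False := by simp; omega
    have e3 : (1 = 2 * d + 3) = False := by simp
    simp only [Function.update_apply, Op.eval, e1, e2, e3, if_true, if_false, BitVec.toNat_add,
      BitVec.toNat_mul, BitVec.toNat_ofNat, h.base, show (2 * d + 1 = 2 * d + 3) = False by simp]
    -- Nothing wraps around: the index is below `Γ.len`, so `16` and the final address are both
    -- below `2 ^ w` by `hΓ.len`, and the other values do not exceed these.
    rw [Nat.mod_eq_of_lt (a := 16) (by omega), Nat.mod_eq_of_lt (a := A.idx) (by omega),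
      Nat.mod_eq_of_lt (a := (σ.reg (2 * d + 1)).toNat * 16) (by omega),
      Nat.mod_eq_of_lt (a := (σ.reg (2 * d + 1)).toNat * 16 + A.idx) (by omega),
      Nat.mod_eq_of_lt (by omega)]
    ring
  · intro d' h1 h2
    simp [Function.update_apply, show d' ≠ d by omega, show 2 * d' ≠ 2 * d + 2 by omega]

/-- The clause `SameTemps` makes the induction work: the right operand is evaluated one level higher
on the stack, so the value of the left one survives. -/
theorem Expr.code_exec (hΓ : Γ.Fits w) (e : Expr) :
    ∀ {σ : State w} {d : ℕ}, 1 ≤ d → Rep Γ σ s → e.Ok Γ s →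
    ∃ σ' : State w, Exec (Γ.base + 16 * Γ.len) (e.code d) σ e.cost σ' ∧ Rep Γ σ' s ∧
      (σ'.reg (2 * d + 1)).toNat = e.eval Γ s ∧ SameTemps d σ σ' := by
  induction e with
  | var a =>
    intro σ d hd h _
    refine ⟨_, .op _ _ _ _ _, h.updateReg hd _, ?_, ?_⟩
    · simp [Op.eval, Expr.eval, h.var]
    · intro d' _ h2
      simp [show d' ≠ d by omega]
  | lit k =>
    intro σ d hd h hk
    refine ⟨_, .const _ _ _, h.updateReg hd _, ?_, ?_⟩
    · have : k < 2 ^ w := lt_of_lt_of_le hk hΓ.bound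
      simp [Expr.eval, Nat.mod_eq_of_lt this]
    · intro d' _ h2
      simp [show d' ≠ d by omega]
  | bin o a b iha ihb =>
    intro σ d hd h ⟨ha, hb, ho⟩
    obtain ⟨σ₁, e₁, r₁, v₁, t₁⟩ := iha hd h ha
    obtain ⟨σ₂, e₂, r₂, v₂, t₂⟩ := ihb (d := d + 1) (by omega) r₁ hb
    have v₁' : (σ₂.reg (2 * d + 1)).toNat = a.eval Γ s := by rw [t₂ d hd (by omega), v₁]
    have v₂' : (σ₂.reg (2 * d + 3)).toNat = b.eval Γ s := v₂
    refine ⟨_, .seq e₁ (.seq e₂ (.op _ _ _ _ _)), r₂.updateReg hd _, ?_, ?_⟩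
    · simp only [Function.update_self, Expr.eval, ← v₁', ← v₂']
      exact NatOp.toNat_eval hΓ.bound _ _ _ (by rw [v₁', v₂']; exact ho)
    · intro d' h1 h2
      simp only [Function.update_apply]
      rw [if_neg (by omega), t₂ d' h1 (by omega), t₁ d' h1 h2]
  | inp a iha =>
    intro σ d hd h ⟨ha, hi⟩
    obtain ⟨σ₁, e₁, r₁, v₁, t₁⟩ := iha hd h ha
    refine ⟨_, .seq e₁ (.load _ _ _ (by rw [v₁]; omega)), r₁.updateReg hd _, ?_, ?_⟩
    · simp only [Function.update_self, Expr.eval, ← v₁]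
      exact r₁.inp _ (by rw [v₁]; exact hi)
    · intro d' h1 h2
      simp only [Function.update_apply]
      rw [if_neg (by omega), t₁ d' h1 h2]
  | get A a iha =>
    intro σ d hd h ⟨ha, hi⟩
    obtain ⟨σ₁, e₁, r₁, v₁, t₁⟩ := iha hd h ha
    obtain ⟨σ₂, e₂, r₂, v₂, t₂, m₂⟩ := addrCode_exec hΓ r₁ A hd (by rw [v₁]; exact hi)
    have hA := A.idx_lt
    rw [v₁] at v₂
    refine ⟨_, .seq e₁ (.seq e₂ (.load _ _ _ (by rw [v₂]; omega))), r₂.updateReg hd _, ?_, ?_⟩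
    · simp only [Function.update_self, Expr.eval, v₂]
      exact r₂.arr _ _ hi
    · intro d' h1 h2
      simp only [Function.update_apply]
      rw [if_neg (by omega), t₂ d' h1 h2, t₁ d' h1 h2]

/-! ### Commands, weakest preconditions and soundness -/

/-- The truth value of a comparison of natural numbers. -/
def Cmp.Test : Cmp → ℕ → ℕ → Prop
  | .eq, x, y => x = y
  | .ne, x, y => x ≠ y
  | .lt, x, y => x < y
  | .le, x, y => x ≤ y

theorem Cmp.holds_iff (c : Cmp) (x y : BitVec w) : c.Holds x y ↔ c.Test x.toNat y.toNat := by
  cases c <;> simp [Cmp.Holds, Cmp.Test, BitVec.toNat_eq]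

/-- Structured programs. -/
inductive Cmd where
  | set (a : Var) (e : Expr)
  | put (A : Arr) (i e : Expr)
  | emit (e : Expr)
  | skip
  | seq (p q : Cmd)
  | ite (c : Cmp) (a b : Expr) (p q : Cmd)
  | loop (c : Cmp) (a b : Expr) (p : Cmd)

namespace Cmd

/-- The machine code that evaluates the two sides of a comparison. -/
def testCode (a b : Expr) : Prog :=
  .seq (a.code 1) (b.code 2)

/-- The machine code of a structured program. -/
def code : Cmd → Prog
  | set a e => .seq (e.code 1) (.op .or (2 * a.idx) 3 3)
  | put A i e => .seq (i.code 1) (.seq (Expr.addrCode A 1) (.seq (e.code 2) (.store 3 5)))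
  | emit e => .seq (e.code 1) (.output 3)
  | skip => .skip
  | seq p q => .seq p.code q.code
  | ite c a b p q => .seq (testCode a b) (.ite c 3 5 p.code q.code)
  | loop c a b p => .seq (testCode a b) (.loop c 3 5 (.seq p.code (testCode a b)))

/-- The weakest precondition of a structured program, with invariants and a measure for loops. -/
def wp (Γ : Ctx) : Cmd → (Env → Prop) → Env → Prop
  | set a e, Q, s => e.Ok Γ s ∧ Q ((s.set a (e.eval Γ s)).tick (e.cost + 1))
  | put A i e, Q, s => i.Ok Γ s ∧ i.eval Γ s < Γ.len ∧ e.Ok Γ s ∧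
      Q ((s.put A (i.eval Γ s) (e.eval Γ s)).tick (i.cost + e.cost + 6))
  | emit e, Q, s => e.Ok Γ s ∧ Q ((s.emit (e.eval Γ s)).tick (e.cost + 1))
  | skip, Q, s => Q (s.tick 1)
  | seq p q, Q, s => p.wp Γ (q.wp Γ Q) s
  | ite c a b p q, Q, s => a.Ok Γ s ∧ b.Ok Γ s ∧
      (c.Test (a.eval Γ s) (b.eval Γ s) → p.wp Γ Q (s.tick (a.cost + b.cost + 1))) ∧
      (¬ c.Test (a.eval Γ s) (b.eval Γ s) → q.wp Γ Q (s.tick (a.cost + b.cost + 1)))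
  | loop c a b p, Q, s => ∃ (I : Env → Prop) (μ : Env → ℕ), I s ∧ ∀ s, I s →
      a.Ok Γ s ∧ b.Ok Γ s ∧
      (c.Test (a.eval Γ s) (b.eval Γ s) →
        p.wp Γ (fun s' => I s' ∧ μ s' < μ s) (s.tick (a.cost + b.cost + 1))) ∧
      (¬ c.Test (a.eval Γ s) (b.eval Γ s) → Q (s.tick (a.cost + b.cost + 1)))

theorem wp_seq (p q : Cmd) (Q : Env → Prop) (s : Env) :
    (seq p q).wp Γ Q s = p.wp Γ (q.wp Γ Q) s := rfl

theorem wp_set (a : Var) (e : Expr) (Q : Env → Prop) (s : Env) :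
    (set a e).wp Γ Q s = (e.Ok Γ s ∧ Q ((s.set a (e.eval Γ s)).tick (e.cost + 1))) := rfl

theorem wp_put (A : Arr) (i e : Expr) (Q : Env → Prop) (s : Env) :
    (put A i e).wp Γ Q s = (i.Ok Γ s ∧ i.eval Γ s < Γ.len ∧ e.Ok Γ s ∧
      Q ((s.put A (i.eval Γ s) (e.eval Γ s)).tick (i.cost + e.cost + 6))) := rfl

theorem wp_mono {c : Cmd} {Q Q' : Env → Prop} (hQ : ∀ s, Q s → Q' s) :
    ∀ {s}, c.wp Γ Q s → c.wp Γ Q' s := by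
  induction c generalizing Q Q' with
  | set a e => exact fun h => ⟨h.1, hQ _ h.2⟩
  | put A i e => exact fun h => ⟨h.1, h.2.1, h.2.2.1, hQ _ h.2.2.2⟩
  | emit e => exact fun h => ⟨h.1, hQ _ h.2⟩
  | skip => exact fun h => hQ _ h
  | seq p q ihp ihq => exact fun h => ihp (fun _ => ihq hQ) h
  | ite c a b p q ihp ihq =>
    exact fun h => ⟨h.1, h.2.1, fun hc => ihp hQ (h.2.2.1 hc), fun hc => ihq hQ (h.2.2.2 hc)⟩
  | loop c a b p ih =>
    rintro s ⟨I, μ, hs, h⟩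
    exact ⟨I, μ, hs, fun s hI => ⟨(h s hI).1, (h s hI).2.1, (h s hI).2.2.1,
      fun hc => hQ _ ((h s hI).2.2.2 hc)⟩⟩

/-- The loop rule with an invariant that depends on a decreasing number. -/
theorem loop_wp {c : Cmp} {a b : Expr} {p : Cmd} {Q : Env → Prop} (I : ℕ → Env → Prop) {k : ℕ}
    {s : Env} (h0 : I k s) (h : ∀ k s, I k s → a.Ok Γ s ∧ b.Ok Γ s ∧
      (c.Test (a.eval Γ s) (b.eval Γ s) →
        p.wp Γ (fun s' => ∃ k' < k, I k' s') (s.tick (a.cost + b.cost + 1))) ∧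
      (¬ c.Test (a.eval Γ s) (b.eval Γ s) → Q (s.tick (a.cost + b.cost + 1)))) :
    (loop c a b p).wp Γ Q s := by
  -- The measure is the least index at which the invariant holds. The rule is applied at this index,
  -- so that any smaller index reached by the body lowers the infimum.
  refine ⟨fun s => ∃ k, I k s, fun s => sInf {k | I k s}, ⟨k, h0⟩, fun s hs => ?_⟩
  obtain ⟨h1, h2, h3, h4⟩ := h _ s (Nat.sInf_mem hs)
  refine ⟨h1, h2, fun hc => wp_mono ?_ (h3 hc), h4⟩
  rintro s' ⟨k', hk', hI⟩
  exact ⟨⟨k', hI⟩, lt_of_le_of_lt (Nat.sInf_le hI) hk'⟩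

theorem testCode_exec (hΓ : Γ.Fits w) (h : Rep Γ σ s) {a b : Expr} (ha : a.Ok Γ s)
    (hb : b.Ok Γ s) (c : Cmp) :
    ∃ σ' : State w, Exec (Γ.base + 16 * Γ.len) (testCode a b) σ (a.cost + b.cost) σ' ∧
      Rep Γ σ' s ∧ (c.Holds (σ'.reg 3) (σ'.reg 5) ↔ c.Test (a.eval Γ s) (b.eval Γ s)) := by
  obtain ⟨σ₁, e₁, r₁, v₁, -⟩ := Expr.code_exec hΓ a (d := 1) le_rfl h ha
  obtain ⟨σ₂, e₂, r₂, v₂, t₂⟩ := Expr.code_exec hΓ b (d := 2) (by omega) r₁ hb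
  have t₃ := t₂ 1 le_rfl (by omega)
  simp only [Nat.reduceMul, Nat.reduceAdd] at v₁ v₂ t₃
  exact ⟨σ₂, .seq e₁ e₂, r₂, by rw [Cmp.holds_iff, v₂, t₃, v₁]⟩

/-- The compiled program runs as the weakest precondition says. -/
theorem code_exec (hΓ : Γ.Fits w) (p : Cmd) :
    ∀ {Q : Env → Prop} {s : Env} {σ : State w}, Rep Γ σ s → p.wp Γ Q s →
    ∃ (t : ℕ) (σ' : State w) (s' : Env), Exec (Γ.base + 16 * Γ.len) p.code σ t σ' ∧
      Rep Γ σ' s' ∧ s'.time = s.time + t ∧ Q s' := by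
  induction p with
  | set a e =>
    intro Q s σ h ⟨he, hq⟩
    obtain ⟨σ₁, e₁, r₁, v₁, -⟩ := Expr.code_exec hΓ e (d := 1) le_rfl h he
    simp only [Nat.reduceMul, Nat.reduceAdd] at v₁
    refine ⟨_, _, _, .seq e₁ (.op _ _ _ _ _), Rep.tick (Rep.set r₁ _ _) _, rfl, ?_⟩
    simpa [Op.eval, v₁] using hq
  | put A i e =>
    intro Q s σ h ⟨hi, hlt, he, hq⟩
    obtain ⟨σ₁, e₁, r₁, v₁, -⟩ := Expr.code_exec hΓ i (d := 1) le_rfl h hi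
    obtain ⟨σ₂, e₂, r₂, v₂, -⟩ := Expr.addrCode_exec hΓ r₁ A le_rfl (by rw [v₁]; exact hlt)
    obtain ⟨σ₃, e₃, r₃, v₃, t₃⟩ := Expr.code_exec hΓ e (d := 2) (by omega) r₂ he
    rw [v₁] at v₂
    have ht := t₃ 1 le_rfl (by omega)
    simp only [Nat.reduceMul, Nat.reduceAdd] at v₂ v₃ ht
    have hA := A.idx_lt
    refine ⟨_, _, _, .seq e₁ (.seq e₂ (.seq e₃ (.store _ _ _ ?_))), ?_, ?_, hq⟩
    · rw [ht, v₂]; omega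
    · have := (Rep.put r₃ A (i.eval Γ s) (σ₃.reg 5)).tick (i.cost + e.cost + 6)
      rw [ht, v₂]
      rwa [v₃] at this
    · simp only [Env.tick_time, Env.put_time]; ring
  | emit e =>
    intro Q s σ h ⟨he, hq⟩
    obtain ⟨σ₁, e₁, r₁, v₁, -⟩ := Expr.code_exec hΓ e (d := 1) le_rfl h he
    simp only [Nat.reduceMul, Nat.reduceAdd] at v₁
    refine ⟨_, _, _, .seq e₁ (.output _ _), Rep.tick (Rep.emit r₁ _) _, rfl, ?_⟩
    simpa [v₁] using hq
  | skip => exact fun h hq => ⟨_, _, _, .skip _, h.tick 1, rfl, hq⟩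
  | seq p q ihp ihq =>
    intro Q s σ h hq
    obtain ⟨t₁, σ₁, s₁, e₁, r₁, ht₁, hq₁⟩ := ihp h hq
    obtain ⟨t₂, σ₂, s₂, e₂, r₂, ht₂, hq₂⟩ := ihq r₁ hq₁
    exact ⟨_, _, _, .seq e₁ e₂, r₂, by omega, hq₂⟩
  | ite c a b p q ihp ihq =>
    intro Q s σ h ⟨ha, hb, hp, hq⟩
    obtain ⟨σ₁, e₁, r₁, hc⟩ := testCode_exec hΓ h ha hb c
    by_cases hh : c.Test (a.eval Γ s) (b.eval Γ s)
    · obtain ⟨t₂, σ₂, s₂, e₂, r₂, ht₂, hq₂⟩ := ihp (r₁.tick _) (hp hh)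
      exact ⟨_, _, _, .seq e₁ (.ite_true (hc.2 hh) e₂), r₂, by
        rw [ht₂, Env.tick_time]; omega, hq₂⟩
    · obtain ⟨t₂, σ₂, s₂, e₂, r₂, ht₂, hq₂⟩ := ihq (r₁.tick _) (hq hh)
      exact ⟨_, _, _, .seq e₁ (.ite_false (mt hc.1 hh) e₂), r₂, by
        rw [ht₂, Env.tick_time]; omega, hq₂⟩
  | loop c a b p ih =>
    rintro Q s σ h ⟨I, μ, hI, hstep⟩
    -- The machine loop compares registers that were filled beforehand, before the loop or at the
    -- end of its body. Each iteration therefore starts with a test already evaluated, whose cost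
    -- appears separately in the time equation.
    suffices hloop : ∀ (N : ℕ) (s : Env) (σ σ₁ : State w), μ s < N → I s → Rep Γ σ₁ s →
        (c.Holds (σ₁.reg 3) (σ₁.reg 5) ↔ c.Test (a.eval Γ s) (b.eval Γ s)) →
        ∃ (t : ℕ) (σ' : State w) (s' : Env), Exec (Γ.base + 16 * Γ.len)
          (.loop c 3 5 (.seq p.code (testCode a b))) σ₁ t σ' ∧
          Rep Γ σ' s' ∧ s'.time = s.time + (a.cost + b.cost) + t ∧ Q s' by
      obtain ⟨σ₁, e₁, r₁, hc⟩ := testCode_exec hΓ h (hstep s hI).1 (hstep s hI).2.1 c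
      obtain ⟨t, σ', s', e', r', ht, hq⟩ := hloop _ s σ σ₁ (Nat.lt_succ_self _) hI r₁ hc
      exact ⟨_, _, _, .seq e₁ e', r', by omega, hq⟩
    intro N
    induction N with
    | zero => intro s σ σ₁ hμ; omega
    | succ N ihN =>
      intro s σ σ₁ hμ hI r₁ hc
      obtain ⟨ha, hb, hp, hq⟩ := hstep s hI
      by_cases hh : c.Test (a.eval Γ s) (b.eval Γ s)
      · obtain ⟨t₂, σ₂, s₂, e₂, r₂, ht₂, hI₂, hμ₂⟩ := ih (r₁.tick _) (hp hh)
        obtain ⟨σ₃, e₃, r₃, hc₃⟩ := testCode_exec hΓ r₂ (hstep s₂ hI₂).1 (hstep s₂ hI₂).2.1 c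
        obtain ⟨t₄, σ₄, s₄, e₄, r₄, ht₄, hq₄⟩ := ihN s₂ σ₂ σ₃ (by omega) hI₂ r₃ hc₃
        refine ⟨_, _, _, .loop_true (hc.2 hh) (.seq e₂ e₃) e₄, r₄, ?_, hq₄⟩
        rw [ht₄, ht₂, Env.tick_time]; omega
      · refine ⟨_, _, _, .loop_false (mt hc.1 hh), r₁.tick _, ?_, hq hh⟩
        rw [Env.tick_time]; omega

end Cmd

attribute [simp] NatOp.eval NatOp.Safe Expr.eval Expr.Ok Expr.cost Cmp.Test

end WordRAM

/-! ### Words along the paths of a tree -/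

namespace UnrootedTree

variable {n σ : ℕ} (T : UnrootedTree n σ)

/-- The word read along the simple path from `x` to `y`, as a list of natural numbers. -/
noncomputable def natWord (x y : Fin n) : List ℕ :=
  (T.walkWord (T.path x y)).map Fin.val

open Classical in
/-- The label of the edge between two adjacent nodes, as a natural number. -/
noncomputable def natLabel (x y : Fin n) : ℕ :=
  if h : T.graph.Adj x y then (T.label ⟨s(x, y), h⟩).val else 0

theorem natLabel_of_adj {x y : Fin n} (h : T.graph.Adj x y) :
    T.natLabel x y = (T.label ⟨s(x, y), h⟩).val :=
  dif_pos h

theorem natLabel_comm (x y : Fin n) : T.natLabel x y = T.natLabel y x := by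
  by_cases h : T.graph.Adj x y
  · rw [natLabel_of_adj T h, natLabel_of_adj T h.symm]
    congr 3
    exact Sym2.eq_swap
  · rw [natLabel, natLabel, dif_neg h, dif_neg (fun h' => h h'.symm)]

/-- The simple path from `x` to `z` consists of the one to `y` and an edge from `y` to `z`. -/
def Extends (x y z : Fin n) : Prop :=
  ∃ h : T.graph.Adj y z, T.path x z = (T.path x y).concat h

/-- The first node after `x` on the simple path from `x` to `y` is `f`. -/
def FirstStep (x y f : Fin n) : Prop :=
  ∃ h : T.graph.Adj x f, T.path x y = .cons h (T.path f y)

theorem path_self (x : Fin n) : T.path x x = .nil :=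
  (T.eq_path SimpleGraph.Walk.IsPath.nil).symm

theorem walkWord_append {x y z : Fin n} (p : T.graph.Walk x y) (q : T.graph.Walk y z) :
    T.walkWord (p.append q) = T.walkWord p ++ T.walkWord q := by
  induction p with
  | nil => rfl
  | cons h p ih => simp [walkWord, ih]

theorem natWord_self (x : Fin n) : T.natWord x x = [] := by
  simp [natWord, path_self, walkWord]

theorem path_of_adj {x y : Fin n} (h : T.graph.Adj x y) :
    T.path x y = .cons h .nil :=
  (T.eq_path (by simpa using h.ne)).symm

/-- If `z` lies on the path from `x` to `y`, the rest of that path from `z` on is the edge to `y`,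
by uniqueness of simple paths. Otherwise appending `z` keeps the path simple. -/
theorem extends_or_extends (x : Fin n) {y z : Fin n} (h : T.graph.Adj y z) :
    T.Extends x y z ∨ T.Extends x z y := by
  by_cases hz : z ∈ (T.path x y).support
  · right
    refine ⟨h.symm, ?_⟩
    have h1 := T.eq_path ((T.path_isPath x y).takeUntil hz)
    have h2 := T.eq_path ((T.path_isPath x y).dropUntil hz)
    rw [T.path_of_adj h.symm] at h2
    rw [← h1, SimpleGraph.Walk.concat_eq_append, ← h2]
    exact ((T.path x y).take_spec hz).symm
  · left
    exact ⟨h, (T.eq_path ((T.path_isPath x y).concat hz h)).symm⟩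

variable {T}

theorem Extends.natWord {x y z : Fin n} (h : T.Extends x y z) :
    T.natWord x z = T.natWord x y ++ [T.natLabel y z] := by
  obtain ⟨h, e⟩ := h
  rw [UnrootedTree.natWord, e, SimpleGraph.Walk.concat_eq_append, walkWord_append,
    natLabel_of_adj T h]
  simp [walkWord, UnrootedTree.natWord]

theorem FirstStep.natWord {x y f : Fin n} (h : T.FirstStep x y f) :
    T.natWord x y = T.natLabel x f :: T.natWord f y := by
  obtain ⟨h, e⟩ := h
  rw [UnrootedTree.natWord, e, walkWord, natLabel_of_adj T h]
  rfl

theorem FirstStep.of_adj {x y : Fin n} (h : T.graph.Adj x y) : T.FirstStep x y y :=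
  ⟨h, by rw [T.path_of_adj h, path_self]⟩

/-- This is what lets the first step of a path be inherited from its prefix in constant time. -/
theorem FirstStep.extend {x y f z : Fin n} (hf : T.FirstStep x y f) (h : T.Extends x y z) :
    T.FirstStep x z f := by
  obtain ⟨hxf, e⟩ := hf
  obtain ⟨hyz, e'⟩ := h
  refine ⟨hxf, ?_⟩
  have hp := T.path_isPath x z
  rw [e', e, SimpleGraph.Walk.concat_cons] at hp
  rw [e', e, SimpleGraph.Walk.concat_cons, T.eq_path hp.of_cons]

theorem Extends.ne {x y z : Fin n} (h : T.Extends x y z) : x ≠ z := by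
  rintro rfl
  obtain ⟨h, e⟩ := h
  have := congrArg SimpleGraph.Walk.length e
  simp [path_self] at this

variable (T)

theorem mem_language_iff {z : List (Fin σ)} :
    z ∈ T.language ↔ ∃ x y, T.walkWord (T.path x y) = z := by
  constructor
  · rintro ⟨x, y, p, hp, e⟩
    exact ⟨x, y, by rw [← T.eq_path hp, e]⟩
  · rintro ⟨x, y, e⟩
    exact ⟨x, y, T.path x y, T.path_isPath x y, e⟩

theorem map_val_mem_iff {z : List (Fin σ)} :
    z ∈ T.language ↔ ∃ x y, T.natWord x y = z.map Fin.val := by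
  rw [mem_language_iff]
  refine exists_congr fun x => exists_congr fun y => ?_
  exact ((List.map_injective_iff.2 Fin.val_injective).eq_iff).symm

/-- Connectedness as an induction principle; it will show that every pair is eventually classified.
-/
theorem of_adj_closed {S : Fin n → Prop} (x : Fin n) (hx : S x)
    (h : ∀ y z, T.graph.Adj y z → S y → S z) (y : Fin n) : S y := by
  have key : ∀ {a b : Fin n}, T.graph.Walk a b → S a → S b := by
    intro a b p
    induction p with
    | nil => exact id
    | cons hadj p ih => exact fun ha => ih (h _ _ hadj ha)
  exact key (T.path x y) hx

end UnrootedTree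

/-! ### Numbering of pairs and linked lists -/

/-- The number of a pair of nodes. -/
def pairIdx {n : ℕ} (p : Fin n × Fin n) : ℕ := p.1 * n + p.2

theorem pairIdx_div {n : ℕ} (p : Fin n × Fin n) : pairIdx p / n = p.1 := by
  have := p.2.isLt
  rw [pairIdx, mul_comm, Nat.mul_add_div (by omega), Nat.div_eq_of_lt this, add_zero]

theorem pairIdx_mod {n : ℕ} (p : Fin n × Fin n) : pairIdx p % n = p.2 := by
  rw [pairIdx, mul_comm, Nat.mul_add_mod, Nat.mod_eq_of_lt p.2.isLt]

theorem pairIdx_injective {n : ℕ} : Function.Injective (pairIdx (n := n)) := by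
  intro p q h
  ext
  · rw [← pairIdx_div, h, pairIdx_div]
  · rw [← pairIdx_mod, h, pairIdx_mod]

theorem pairIdx_lt {n : ℕ} (p : Fin n × Fin n) : pairIdx p < n * n := by
  have h1 := p.1.isLt
  have h2 := p.2.isLt
  calc pairIdx p < p.1 * n + n := by simp [pairIdx]
    _ = (p.1 + 1) * n := by ring
    _ ≤ n * n := Nat.mul_le_mul_right _ h1

/-- The linked list with successor pointers `next` that starts with the pointer `h` has the cells
`l`. A pointer to the cell `a` is stored as `a + 1`, and `0` is the end of the list. -/
def IsLinked (next : ℕ → ℕ) : ℕ → List ℕ → Prop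
  | h, [] => h = 0
  | h, a :: l => h = a + 1 ∧ IsLinked next (next a) l

theorem IsLinked.update {next : ℕ → ℕ} {a v : ℕ} {l : List ℕ} (ha : a ∉ l) :
    ∀ {h : ℕ}, IsLinked next h l → IsLinked (Function.update next a v) h l := by
  induction l with
  | nil => exact id
  | cons b l ih =>
    rintro h ⟨h1, h2⟩
    rw [List.mem_cons, not_or] at ha
    exact ⟨h1, by rw [Function.update_of_ne (Ne.symm ha.1)]; exact ih ha.2 h2⟩

theorem IsLinked.push {next : ℕ → ℕ} {a h : ℕ} {l : List ℕ} (ha : a ∉ l) (hl : IsLinked next h l) :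
    IsLinked (Function.update next a h) (a + 1) (a :: l) :=
  ⟨rfl, by rw [Function.update_self]; exact hl.update ha⟩

/-! ### The trie of the words of a tree -/

/-- No smaller number carries the same letter as `b`. -/
def IsRank (lam : ℕ → ℕ) (b : ℕ) : Prop := ∀ j < b, lam j ≠ lam b

/-- Ranks name letters faithfully, so they can replace letters as array indices even if the alphabet
is much larger than `n`. -/
theorem IsRank.inj {lam : ℕ → ℕ} {b b' : ℕ} (h : IsRank lam b) (h' : IsRank lam b')
    (e : lam b = lam b') : b = b' := by
  rcases lt_trichotomy b b' with hlt | rfl | hlt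
  · exact absurd e (h' b hlt)
  · rfl
  · exact absurd e.symm (h b' hlt)

/-- The numbers `0, …, m - 1` are the nodes of a trie; the node `k` stands for the word `W k` and
has the parent `par k`. The children of the nodes before `v` are complete and consecutive; some
children of `v` have been created, and `child` finds them by the ranks of their letters. -/
structure TrieNodes (lam : ℕ → ℕ) (N v m : ℕ) (start letter child : ℕ → ℕ) (W : ℕ → List ℕ)
    (par : ℕ → ℕ) : Prop where
  pos : 0 < m
  root : W 0 = []
  inj : ∀ c < m, ∀ c' < m, W c = W c' → c = c'
  node : ∀ k, 0 < k → k < m → par k ≤ v ∧ par k < k ∧ W k = W (par k) ++ [lam (letter k)] ∧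
    IsRank lam (letter k) ∧ letter k + 1 < N
  mono : ∀ c < v, start c ≤ start (c + 1)
  start_le : ∀ c ≤ v, start c ≤ m
  range : ∀ c < v, ∀ k, (start c ≤ k ∧ k < start (c + 1)) ↔ (0 < k ∧ k < m ∧ par k = c)
  range_last : ∀ k, (start v ≤ k ∧ k < m) ↔ (0 < k ∧ k < m ∧ par k = v)
  child_lt : ∀ b, child b < m
  letter_child : ∀ b, start v ≤ child b → letter (child b) = b
  child_letter : ∀ k, start v ≤ k → k < m → child (letter k) = k

namespace TrieNodes

variable {lam : ℕ → ℕ} {N v m : ℕ} {start letter child : ℕ → ℕ} {W : ℕ → List ℕ} {par : ℕ → ℕ}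

theorem word_child (h : TrieNodes lam N v m start letter child W par) {b : ℕ}
    (hb : start v ≤ child b) : W (child b) = W v ++ [lam b] := by
  have hm := h.child_lt b
  obtain ⟨h0, -, hp⟩ := (h.range_last _).1 ⟨hb, hm⟩
  have := (h.node _ h0 hm).2.2.1
  rw [this, hp, h.letter_child b hb]

/-- An entry of `child` below `start v` was left by an earlier trie node or is the initial zero, so
`hb` says that `v` has no child with this letter yet. -/
theorem addChild (h : TrieNodes lam N v m start letter child W par) (hv : v < m) {b : ℕ}
    (hr : IsRank lam b) (hbN : b + 1 < N) (hb : child b < start v) :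
    TrieNodes lam N v (m + 1) start (Function.update letter m b) (Function.update child b m)
      (Function.update W m (W v ++ [lam b])) (Function.update par m v) := by
  -- A node with the new word would have parent `v` and letter rank `b`; then `child_letter` would
  -- place `child b` at or above `start v`.
  have hnew : ∀ c < m, W c ≠ W v ++ [lam b] := by
    intro c hc e
    rcases Nat.eq_zero_or_pos c with rfl | hc0
    · simp [h.root] at e
    obtain ⟨h1, h2, h3, h4, -⟩ := h.node c hc0 hc
    rw [h3] at e
    obtain ⟨e1, e2⟩ := List.append_inj' e rfl
    have hp : par c = v := h.inj _ (by omega) _ hv e1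
    have hl : letter c = b := h4.inj hr (by simpa using e2)
    have hs := ((h.range_last c).2 ⟨hc0, hc, hp⟩).1
    have := h.child_letter c hs hc
    rw [hl] at this
    omega
  have hsv := h.start_le v le_rfl
  have hs0 : 0 < start v := by omega
  have hm := h.pos
  refine ⟨by omega, ?_, ?_, ?_, ?_, ?_, ?_, ?_, ?_, ?_, ?_⟩
  · rw [Function.update_of_ne (by omega), h.root]
  · intro c hc c' hc' e
    rcases Nat.lt_succ_iff_lt_or_eq.1 hc with h1 | rfl <;>
      rcases Nat.lt_succ_iff_lt_or_eq.1 hc' with h2 | rfl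
    · rw [Function.update_of_ne (by omega), Function.update_of_ne (by omega)] at e
      exact h.inj _ h1 _ h2 e
    · rw [Function.update_of_ne (by omega), Function.update_self] at e
      exact absurd e (hnew _ h1)
    · rw [Function.update_self, Function.update_of_ne (by omega)] at e
      exact absurd e.symm (hnew _ h2)
    · rfl
  · intro k hk0 hk
    rcases Nat.lt_succ_iff_lt_or_eq.1 hk with h1 | rfl
    · obtain ⟨a1, a2, a3, a4⟩ := h.node k hk0 h1
      rw [Function.update_of_ne (by omega), Function.update_of_ne (by omega),
        Function.update_of_ne (by omega), Function.update_of_ne (by omega)]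
      exact ⟨a1, a2, a3, a4⟩
    · rw [Function.update_self, Function.update_self, Function.update_self,
        Function.update_of_ne (by omega)]
      exact ⟨le_rfl, hv, rfl, hr, hbN⟩
  · exact h.mono
  · exact fun c hc => (h.start_le c hc).trans (Nat.le_succ m)
  · intro c hc k
    have := h.range c hc k
    have h1 := h.start_le (c + 1) hc
    by_cases hk : k = m
    · subst hk
      rw [Function.update_self]; omega
    · rw [Function.update_of_ne hk]; omega
  · intro k
    have := h.range_last k
    by_cases hk : k = m
    · subst hk
      rw [Function.update_self]; omega
    · rw [Function.update_of_ne hk]; omega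
  · intro b'
    have := h.child_lt b'
    rw [Function.update_apply]; split_ifs <;> omega
  · intro b' hb'
    by_cases e : b' = b
    · subst e; simp
    · rw [Function.update_of_ne e] at hb' ⊢
      rw [Function.update_of_ne (h.child_lt b').ne, h.letter_child b' hb']
  · intro k hk hkm
    by_cases e : k = m
    · subst e; simp
    · rw [Function.update_of_ne e]
      have h1 := h.child_letter k hk (by omega)
      rw [Function.update_of_ne, h1]
      rintro e2
      rw [e2] at h1
      omega

/-- Setting the start of the next node to `m` invalidates the whole table `child` at once, since all
its entries are below `m`. -/
theorem next (h : TrieNodes lam N v m start letter child W par) :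
    TrieNodes lam N (v + 1) m (Function.update start (v + 1) m) letter child W par where
  pos := h.pos
  root := h.root
  inj := h.inj
  node k h0 hk := by
    obtain ⟨a1, a2, a3, a4⟩ := h.node k h0 hk
    exact ⟨by omega, a2, a3, a4⟩
  mono c hc := by
    rw [Function.update_of_ne (by omega)]
    rcases Nat.lt_succ_iff_lt_or_eq.1 hc with h1 | rfl
    · rw [Function.update_of_ne (by omega)]
      exact h.mono c h1
    · rw [Function.update_self]
      exact h.start_le c le_rfl
  start_le c hc := by
    rw [Function.update_apply]
    split_ifs
    · exact le_rfl
    · exact h.start_le c (by omega)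
  range c hc k := by
    rw [Function.update_of_ne (by omega : c ≠ v + 1)]
    rcases Nat.lt_succ_iff_lt_or_eq.1 hc with h1 | rfl
    · rw [Function.update_of_ne (by omega)]
      exact h.range c h1 k
    · rw [Function.update_self]
      exact h.range_last k
  range_last k := by
    rw [Function.update_self]
    constructor
    · omega
    · rintro ⟨h0, hk, hp⟩
      have := (h.node k h0 hk).1
      omega
  child_lt := h.child_lt
  letter_child b hb := by
    rw [Function.update_self] at hb
    have := h.child_lt b
    omega
  child_letter k hk := by
    rw [Function.update_self] at hk
    omega

end TrieNodes

/-! ### Classes of pairs that spell the same word -/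

/-- Pairs `p` of nodes with `cls (pairIdx p) = c + 1` have been found to spell the word `W c`; they
form the linked list with head `head c`. The first nodes of their paths are stored in `first`. -/
structure PairClasses {n σ : ℕ} (T : UnrootedTree n σ) (m : ℕ) (cls first head next : ℕ → ℕ)
    (W : ℕ → List ℕ) (Ls : ℕ → List (Fin n × Fin n)) : Prop where
  word : ∀ p c, cls (pairIdx p) = c + 1 → c < m ∧ W c = T.natWord p.1 p.2
  linked : ∀ c, IsLinked next (head c) ((Ls c).map pairIdx)
  nodup : ∀ c, (Ls c).Nodup
  mem : ∀ c p, p ∈ Ls c ↔ cls (pairIdx p) = c + 1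
  diag : ∀ x : Fin n, cls (pairIdx (x, x)) = 1
  closed : ∀ x y z : Fin n, T.Extends x y z → cls (pairIdx (x, z)) ≠ 0 → cls (pairIdx (x, y)) ≠ 0
  firstStep : ∀ x y : Fin n, cls (pairIdx (x, y)) ≠ 0 → x ≠ y →
    ∃ f : Fin n, first (pairIdx (x, y)) = f ∧ T.FirstStep x y f

namespace PairClasses

variable {n σ : ℕ} {T : UnrootedTree n σ} {m : ℕ} {cls first head next : ℕ → ℕ}
  {W : ℕ → List ℕ} {Ls : ℕ → List (Fin n × Fin n)}

theorem mono (h : PairClasses T m cls first head next W Ls) (u : List ℕ) :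
    PairClasses T (m + 1) cls first head next (Function.update W m u) Ls where
  word p c hc := by
    have := h.word p c hc
    rw [Function.update_of_ne (by omega)]
    exact ⟨by omega, this.2⟩
  linked := h.linked
  nodup := h.nodup
  mem := h.mem
  diag := h.diag
  closed := h.closed
  firstStep := h.firstStep

theorem insert (h : PairClasses T m cls first head next W Ls) {x y z f : Fin n} {c : ℕ}
    (hext : T.Extends x y z) (hxy : cls (pairIdx (x, y)) ≠ 0) (hxz : cls (pairIdx (x, z)) = 0)
    (hc : c < m) (hw : W c = T.natWord x z) (hf : T.FirstStep x z f) :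
    PairClasses T m (Function.update cls (pairIdx (x, z)) (c + 1))
      (Function.update first (pairIdx (x, z)) f)
      (Function.update head c (pairIdx (x, z) + 1))
      (Function.update next (pairIdx (x, z)) (head c)) W
      (Function.update Ls c ((x, z) :: Ls c)) := by
  have hnot : ∀ c', (x, z) ∉ Ls c' := by
    intro c' hc'
    rw [h.mem] at hc'
    omega
  have hnot' : ∀ c', pairIdx (x, z) ∉ (Ls c').map pairIdx := by
    intro c' hc'
    rw [List.mem_map_of_injective pairIdx_injective] at hc'
    exact hnot c' hc'
  have hne : ∀ {p : Fin n × Fin n}, p ≠ (x, z) → pairIdx p ≠ pairIdx (x, z) :=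
    fun hp => pairIdx_injective.ne hp
  refine ⟨?_, ?_, ?_, ?_, ?_, ?_, ?_⟩
  · intro p c' hp
    by_cases e : p = (x, z)
    · subst e
      rw [Function.update_self] at hp
      obtain rfl : c = c' := by omega
      exact ⟨hc, hw⟩
    · rw [Function.update_of_ne (hne e)] at hp
      exact h.word p c' hp
  · intro c'
    by_cases e : c' = c
    · subst e
      rw [Function.update_self, Function.update_self, List.map_cons]
      exact (h.linked c').push (hnot' c')
    · rw [Function.update_of_ne e, Function.update_of_ne e]
      exact (h.linked c').update (hnot' c')
  · intro c'
    by_cases e : c' = c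
    · subst e
      rw [Function.update_self]
      exact List.nodup_cons.2 ⟨hnot c', h.nodup c'⟩
    · rw [Function.update_of_ne e]
      exact h.nodup c'
  · intro c' p
    have h1 := h.mem c' p
    have h2 := hnot c'
    by_cases e : c' = c <;> by_cases ep : p = (x, z)
    · subst e ep; simp
    · subst e
      rw [Function.update_self, Function.update_of_ne (hne ep), List.mem_cons]
      simpa [ep] using h1
    · subst ep
      rw [Function.update_of_ne e, Function.update_self]
      simpa [Ne.symm e] using h2
    · rw [Function.update_of_ne e, Function.update_of_ne (hne ep)]
      exact h1
  · intro a
    rw [Function.update_of_ne (hne _)]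
    · exact h.diag a
    · intro e
      rw [← e, h.diag a] at hxz
      omega
  · intro a b d habd hd
    by_cases e : (a, b) = (x, z)
    · rw [e, Function.update_self]; omega
    · rw [Function.update_of_ne (hne e)]
      by_cases e' : (a, d) = (x, z)
      · obtain ⟨rfl, rfl⟩ := Prod.mk.inj e'
        obtain ⟨h1, p1⟩ := habd
        obtain ⟨h2, p2⟩ := hext
        -- The only prefix to check is the path without its last edge, and its end is determined as
        -- the penultimate node.
        obtain rfl : b = y := by
          have := congrArg SimpleGraph.Walk.penultimate (p1.symm.trans p2)
          simpa using this
        exact hxy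
      · rw [Function.update_of_ne (hne e')] at hd
        exact h.closed a b d habd hd
  · intro a b hab hne'
    by_cases e : (a, b) = (x, z)
    · obtain ⟨rfl, rfl⟩ := Prod.mk.inj e
      exact ⟨f, by rw [Function.update_self], hf⟩
    · rw [Function.update_of_ne (hne e)] at hab ⊢
      exact h.firstStep a b hab hne'

/-- A pair has a single class, so choosing a pair in every nonempty class is injective. This bounds
the trie and keeps all array indices in range. -/
theorem le_mul (h : PairClasses T m cls first head next W Ls) (hne : ∀ c < m, Ls c ≠ []) :
    m ≤ n * n := by
  have h1 : ∀ c : Fin m, ∃ p : Fin n × Fin n, cls (pairIdx p) = c + 1 := by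
    intro c
    obtain ⟨p, hp⟩ := List.exists_mem_of_ne_nil _ (hne c c.isLt)
    exact ⟨p, (h.mem c p).1 hp⟩
  choose g hg using h1
  have : Function.Injective g := by
    intro a b e
    have ha := hg a
    rw [e, hg b] at ha
    exact Fin.ext (by omega)
  simpa using Fintype.card_le_of_injective g this

end PairClasses

/-! ### Adjacency lists -/

namespace WordRAM

set_option linter.constructorNameAsVariable false

infixr:60 " ;; " => Cmd.seq

/-- The letter of the edge whose number is given by an expression. -/
def edgeLetter (e : Expr) : Expr :=
  .inp (.bin .add (.bin .mul (.lit 3) e) (.lit 3))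

/-- Search the first edge with the same letter as the edge `i`. -/
def findRank : Cmd :=
  .set .j (.lit 0) ;;
  .loop .ne (edgeLetter (.var .j)) (edgeLetter (.var .i)) (.set .j (.bin .add (.var .j) (.lit 1)))

/-- Insert the cell `p` for the neighbour `z` of `y` into the adjacency list of `y`. -/
def pushDart : Cmd :=
  .put .adjNext (.var .p) (.get .adjHead (.var .y)) ;;
  .put .adjHead (.var .y) (.bin .add (.var .p) (.lit 1)) ;;
  .put .adjNode (.var .p) (.var .z) ;;
  .put .adjRank (.var .p) (.var .j)

/-- Insert the edge `i` into the adjacency lists of its ends. -/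
def insertEdge : Cmd :=
  findRank ;;
  .set .p (.bin .mul (.lit 2) (.var .i)) ;;
  .set .y (.inp (.bin .add (.bin .mul (.lit 3) (.var .i)) (.lit 1))) ;;
  .set .z (.inp (.bin .add (.bin .mul (.lit 3) (.var .i)) (.lit 2))) ;;
  pushDart ;;
  .set .p (.bin .add (.var .p) (.lit 1)) ;;
  .set .z (.var .y) ;;
  .set .y (.inp (.bin .add (.bin .mul (.lit 3) (.var .i)) (.lit 2))) ;;
  pushDart ;;
  .set .i (.bin .add (.var .i) (.lit 1))

/-- Build the adjacency lists. -/
def buildAdjacency : Cmd :=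
  .set .n (.inp (.lit 0)) ;;
  .set .i (.lit 0) ;;
  .loop .lt (.bin .add (.var .i) (.lit 1)) (.var .n) insertEdge

/-- The input and the sizes that belong to a tree with edge list `es`. -/
structure Ctx.Encodes {n σ : ℕ} (Γ : Ctx) (T : UnrootedTree n σ) (es : List T.graph.Dart) :
    Prop where
  length : es.length + 1 = n
  nodes : Γ.inp 0 = n
  fst : ∀ (i : ℕ) (h : i < es.length), Γ.inp (3 * i + 1) = es[i].fst
  snd : ∀ (i : ℕ) (h : i < es.length), Γ.inp (3 * i + 2) = es[i].snd
  label : ∀ (i : ℕ) (h : i < es.length),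
    Γ.inp (3 * i + 3) = T.natLabel es[i].fst es[i].snd
  base : Γ.base = 3 * n
  len : Γ.len = n * n + 2 * n + 1
  bound : Γ.bound = n * n + 3 * n + 20

/-- The letter of an edge. -/
def Ctx.lam (Γ : Ctx) (b : ℕ) : ℕ := Γ.inp (3 * b + 3)

/-- The arrays that are not used for the adjacency lists hold zeros, and nothing is output. -/
def Env.Fresh (s : Env) : Prop :=
  s.out = [] ∧ s.arr .cls = 0 ∧ s.arr .next = 0 ∧ s.arr .head = 0 ∧ s.arr .first = 0 ∧
    s.arr .start = 0 ∧ s.arr .letter = 0 ∧ s.arr .child = 0 ∧ s.arr .mark = 0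

/-- The arrays `head`, `next`, `node`, `rank` hold `k` cells in adjacency lists with the cells
`D y`, in which the pairs in `E` occur. -/
structure AdjLists {n σ : ℕ} (T : UnrootedTree n σ) (lam : ℕ → ℕ) (head next node rank : ℕ → ℕ)
    (k : ℕ) (E : Set (Fin n × Fin n)) (D : Fin n → List ℕ) : Prop where
  linked : ∀ y : Fin n, IsLinked next (head y) (D y)
  lt : ∀ y, ∀ d ∈ D y, d < k
  adj : ∀ y, ∀ d ∈ D y, ∃ z : Fin n, node d = z ∧ T.graph.Adj y z ∧
    lam (rank d) = T.natLabel y z ∧ IsRank lam (rank d) ∧ rank d + 1 < n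
  cover : ∀ p ∈ E, ∃ d ∈ D p.1, node d = p.2
  total : ∑ y, (D y).length = k

/-- The field `total` is kept as an equality because it is the sum of degrees from which the running
time of the trie construction is computed. -/
theorem AdjLists.push {n σ : ℕ} {T : UnrootedTree n σ} {lam head next node rank : ℕ → ℕ}
    {k : ℕ} {E : Set (Fin n × Fin n)} {D : Fin n → List ℕ}
    (h : AdjLists T lam head next node rank k E D) {y z : Fin n} {r : ℕ}
    (hyz : T.graph.Adj y z) (hr : lam r = T.natLabel y z) (hrank : IsRank lam r) (hrn : r + 1 < n) :
    AdjLists T lam (Function.update head y (k + 1)) (Function.update next k (head y))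
      (Function.update node k z) (Function.update rank k r) (k + 1) (insert (y, z) E)
      (Function.update D y (k :: D y)) := by
  have hk : ∀ y', k ∉ D y' := fun y' hy' => absurd (h.lt _ _ hy') (lt_irrefl _)
  have hmem : ∀ y', ∀ d ∈ D y', d ∈ Function.update D y (k :: D y) y' := by
    intro y' d hd
    by_cases e : y' = y
    · subst e; simp [hd]
    · rwa [Function.update_of_ne e]
  have hmem' : ∀ y', ∀ d ∈ Function.update D y (k :: D y) y', (d = k ∧ y' = y) ∨ d ∈ D y' := by
    intro y' d hd
    by_cases e : y' = y
    · subst e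
      rw [Function.update_self, List.mem_cons] at hd
      tauto
    · rw [Function.update_of_ne e] at hd
      exact Or.inr hd
  refine ⟨?_, ?_, ?_, ?_, ?_⟩
  · intro y'
    by_cases e : y' = y
    · subst e
      rw [Function.update_self, Function.update_self]
      exact (h.linked y').push (hk _)
    · rw [Function.update_of_ne e, Function.update_of_ne (fun h => e (Fin.ext h))]
      exact (h.linked y').update (hk _)
  · intro y' d hd
    rcases hmem' y' d hd with ⟨rfl, -⟩ | hd
    · omega
    · exact (h.lt _ _ hd).trans (Nat.lt_succ_self k)
  · intro y' d hd
    rcases hmem' y' d hd with ⟨rfl, rfl⟩ | hd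
    · exact ⟨z, by simp, hyz, by simpa using hr, by simpa using hrank, by simpa using hrn⟩
    · have := (h.lt _ _ hd).ne
      rw [Function.update_of_ne this, Function.update_of_ne this]
      exact h.adj _ _ hd
  · rintro p (rfl | hp)
    · exact ⟨k, by simp, by simp⟩
    · obtain ⟨d, hd, e⟩ := h.cover p hp
      exact ⟨d, hmem _ _ hd, by rw [Function.update_of_ne (h.lt _ _ hd).ne, e]⟩
  · have h1 := Finset.add_sum_erase Finset.univ
      (fun x => (Function.update D y (k :: D y) x).length) (Finset.mem_univ y)
    have h2 := Finset.add_sum_erase Finset.univ (fun x => (D x).length) (Finset.mem_univ y)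
    have h3 : ∀ x ∈ Finset.univ.erase y,
        (Function.update D y (k :: D y) x).length = (D x).length := by
      intro x hx
      rw [Function.update_of_ne (Finset.ne_of_mem_erase hx)]
    rw [Finset.sum_congr rfl h3] at h1
    simp only [Function.update_self, List.length_cons] at h1
    have := h.total
    omega

section

variable {n σ : ℕ} {Γ : Ctx} {T : UnrootedTree n σ} {es : List T.graph.Dart} {Q : Env → Prop}
  {s : Env}

/-- The search stops at `i` at the latest, so it is linear in `i`; over all edges this stays within
the quadratic budget. -/
theorem findRank_wp (hΓ : Γ.Encodes T es) {i : ℕ} (hi : i < es.length) (hs : s.var .i = i)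
    (hQ : ∀ j t, j ≤ i → IsRank Γ.lam j → Γ.lam j = Γ.lam i → t ≤ 20 * i + 20 →
      Q ((s.set .j j).tick t)) :
    findRank.wp Γ Q s := by
  have hn := hΓ.length
  have hb := hΓ.bound
  have hB := hΓ.base
  refine ⟨by simp [hb], fun s' => ∃ j t, s' = (s.set .j j).tick t ∧ j ≤ i ∧
    (∀ j' < j, Γ.lam j' ≠ Γ.lam i) ∧ t ≤ 20 * j + 2, fun s' => i - s'.var .j,
    ⟨0, 2, by simp, by simp, by simp, by simp⟩, ?_⟩
  rintro s' ⟨j, t, rfl, hj, hne, ht⟩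
  simp only [edgeLetter, Cmd.wp]
  refine ⟨by simp; omega, by simp [hs]; omega, fun hc => ⟨by simp; omega, ?_⟩, fun hc => ?_⟩
  · simp only [Cmp.Test, Expr.eval, NatOp.eval] at hc
    simp only [Env.tick_var, Env.set_var, Function.update_self, ne_eq, reduceCtorEq,
      not_false_eq_true, Function.update_of_ne, hs] at hc
    have hji : j ≠ i := by rintro rfl; exact hc rfl
    -- A round takes 13 steps for the test and 4 for the increment.
    refine ⟨⟨j + 1, t + 17, by simp [add_assoc], by omega, ?_, by omega⟩, by simp; omega⟩
    intro j' hj'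
    rcases Nat.lt_succ_iff_lt_or_eq.1 hj' with h | rfl
    · exact hne j' h
    · exact hc
  · simp [hs] at hc
    have hlam : Γ.lam j = Γ.lam i := hc
    simp only [Env.tick_tick]
    exact hQ j _ hj (fun j' hj' => by rw [hlam]; exact hne j' hj') hlam (by simp; omega)

theorem pushDart_wp (hΓ : Γ.Encodes T es) {k r : ℕ} {y z : Fin n} {E : Set (Fin n × Fin n)}
    {D : Fin n → List ℕ}
    (h : AdjLists T Γ.lam (s.arr .adjHead) (s.arr .adjNext) (s.arr .adjNode) (s.arr .adjRank) k E D)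
    (hs : s.Fresh) (hk : k < 2 * n) (hp : s.var .p = k) (hy : s.var .y = y) (hz : s.var .z = z)
    (hj : s.var .j = r) (hyz : T.graph.Adj y z) (hr : Γ.lam r = T.natLabel y z)
    (hrank : IsRank Γ.lam r) (hrn : r + 1 < n)
    (hQ : ∀ s' : Env, s'.var = s.var → s'.time ≤ s.time + 60 → s'.Fresh →
      AdjLists T Γ.lam (s'.arr .adjHead) (s'.arr .adjNext) (s'.arr .adjNode) (s'.arr .adjRank)
        (k + 1) (insert (y, z) E) (Function.update D y (k :: D y)) → Q s') :
    pushDart.wp Γ Q s := by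
  have hl := hΓ.len
  have hb := hΓ.bound
  have hyn := y.isLt
  simp only [pushDart, Cmd.wp]
  refine ⟨by simp, by simp; omega, by simp; omega, by simp, by simp; omega, by simp; omega,
    by simp, by simp; omega, by simp, by simp, by simp; omega, by simp, ?_⟩
  apply hQ
  · simp
  · simp
  · simpa [Env.Fresh] using hs
  · simpa [hp, hy, hz, hj] using h.push hyz hr hrank hrn

/-- The pairs of ends of the first `i` edges of a list. -/
def edgePairs (es : List T.graph.Dart) (i : ℕ) : Set (Fin n × Fin n) :=
  {p | ∃ (j : ℕ) (h : j < es.length), j < i ∧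
    (p = (es[j].fst, es[j].snd) ∨ p = (es[j].snd, es[j].fst))}

theorem AdjLists.mono {lam head next node rank : ℕ → ℕ} {k : ℕ} {E E' : Set (Fin n × Fin n)}
    {D : Fin n → List ℕ} (h : AdjLists T lam head next node rank k E D) (hE : E' ⊆ E) :
    AdjLists T lam head next node rank k E' D :=
  ⟨h.linked, h.lt, h.adj, fun p hp => h.cover p (hE hp), h.total⟩

/-- The two orientations of edge `i` occupy the cells `2 * i` and `2 * i + 1` and share one rank. -/
theorem insertEdge_wp (hΓ : Γ.Encodes T es) {i : ℕ} (hi : i < es.length) (hn : s.var .n = n)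
    (hs : s.var .i = i) (hf : s.Fresh) {D : Fin n → List ℕ}
    (h : AdjLists T Γ.lam (s.arr .adjHead) (s.arr .adjNext) (s.arr .adjNode) (s.arr .adjRank)
      (2 * i) (edgePairs es i) D) :
    insertEdge.wp Γ (fun s' => s'.var .n = n ∧ s'.var .i = i + 1 ∧ s'.Fresh ∧
      s'.time ≤ s.time + 20 * i + 250 ∧ ∃ D, AdjLists T Γ.lam (s'.arr .adjHead) (s'.arr .adjNext)
        (s'.arr .adjNode) (s'.arr .adjRank) (2 * (i + 1)) (edgePairs es (i + 1)) D) s := by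
  have hes := hΓ.length
  have hb := hΓ.bound
  have hB := hΓ.base
  simp only [insertEdge, Cmd.wp]
  refine findRank_wp hΓ hi hs fun j t hji hrank hlam ht => ?_
  have hlab : Γ.lam j = T.natLabel es[i].fst es[i].snd := by
    rw [hlam]; exact hΓ.label i hi
  refine ⟨by simp [hs]; omega, by simp [hs]; omega, by simp [hs]; omega, ?_⟩
  refine pushDart_wp hΓ (y := es[i].fst) (z := es[i].snd) (r := j) (k := 2 * i) (by simpa using h)
    (by simpa [Env.Fresh] using hf) (by omega) (by simp [hs]) (by simp [hs, hΓ.fst i hi])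
    (by simp [hs, hΓ.snd i hi]) (by simp) es[i].adj hlab hrank (by omega) ?_
  intro s₁ hv₁ ht₁ hf₁ h₁
  refine ⟨by simp [hv₁, hs]; omega, by simp, by simp [hv₁, hs]; omega, ?_⟩
  refine pushDart_wp hΓ (y := es[i].snd) (z := es[i].fst) (r := j) (k := 2 * i + 1)
    (by simpa using h₁) (by simpa [Env.Fresh] using hf₁) (by omega) (by simp [hs, hv₁])
    (by simp [hs, hv₁, hΓ.snd i hi]) (by simp [hs, hv₁, hΓ.fst i hi]) (by simp [hv₁])
    es[i].adj.symm (by rw [hlab, T.natLabel_comm]) hrank (by omega) ?_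
  intro s₂ hv₂ ht₂ hf₂ h₂
  refine ⟨by simp [hv₂, hv₁, hs]; omega, by simp [hv₂, hv₁, hn], by simp [hv₂, hv₁, hs],
    by simpa [Env.Fresh] using hf₂, ?_, _, h₂.mono ?_⟩
  · simp at ht₁ ht₂ ⊢
    omega
  · rintro p ⟨j', hj', hlt, hp⟩
    rcases Nat.lt_succ_iff_lt_or_eq.1 hlt with hlt | rfl
    · exact Or.inr (Or.inr ⟨j', hj', hlt, hp⟩)
    · rcases hp with rfl | rfl
      · exact Or.inr (Or.inl rfl)
      · exact Or.inl rfl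

theorem buildAdjacency_wp (hΓ : Γ.Encodes T es) (hs : ∀ A, s.arr A = 0) (ho : s.out = []) :
    buildAdjacency.wp Γ (fun s' => s'.var .n = n ∧ s'.Fresh ∧
      s'.time ≤ s.time + 300 * (n * n) ∧ ∃ D, AdjLists T Γ.lam (s'.arr .adjHead)
        (s'.arr .adjNext) (s'.arr .adjNode) (s'.arr .adjRank) (2 * es.length)
        (edgePairs es es.length) D) s := by
  have hes := hΓ.length
  have hb := hΓ.bound
  have hB := hΓ.base
  simp only [buildAdjacency, Cmd.wp]
  refine ⟨by simp; omega, by simp; omega, fun s' => ∃ i, s'.var .n = n ∧ s'.var .i = i ∧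
    i ≤ es.length ∧ s'.Fresh ∧ s'.time ≤ s.time + i * (20 * n + 260) + 5 ∧ ∃ D, AdjLists T Γ.lam
      (s'.arr .adjHead) (s'.arr .adjNext) (s'.arr .adjNode) (s'.arr .adjRank) (2 * i)
      (edgePairs es i) D, fun s' => es.length - s'.var .i, ?_, ?_⟩
  · refine ⟨0, by simp [hΓ.nodes], by simp, by simp, by simp [Env.Fresh, hs, ho], by simp, ?_⟩
    refine ⟨fun _ => [], fun y => ?_, by simp, by simp, ?_, by simp⟩
    · simp [hs, IsLinked]
    · rintro p ⟨j, _, hlt, _⟩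
      omega
  · rintro s' ⟨i, hn, hi, hile, hf, ht, D, hD⟩
    refine ⟨by simp [hi]; omega, by simp, fun hc => ?_, fun hc => ?_⟩
    · simp [hi, hn] at hc
      refine Cmd.wp_mono ?_ (insertEdge_wp hΓ (i := i) (by omega) (by simpa using hn)
        (by simpa using hi) (by simpa [Env.Fresh] using hf) (D := D) (by simpa using hD))
      rintro s'' ⟨a1, a2, a3, a4, D', a5⟩
      refine ⟨⟨i + 1, a1, a2, by omega, a3, ?_, D', a5⟩, by simp only [a2, hi]; omega⟩
      simp at a4
      have : (i + 1) * (20 * n + 260) = i * (20 * n + 260) + 20 * n + 260 := by ring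
      omega
    · simp [hi, hn] at hc
      obtain rfl : i = es.length := by omega
      refine ⟨by simpa using hn, by simpa [Env.Fresh] using hf, ?_, D, by simpa using hD⟩
      simp
      nlinarith

end

end WordRAM

/-! ### Building the trie -/

namespace WordRAM

set_option linter.constructorNameAsVariable false

/-- Let `c` be the child of the trie node `v` for the letter with rank `b`. -/
def findChild : Cmd :=
  .ite .lt (.get .child (.var .b)) (.get .start (.var .v))
    (.put .child (.var .b) (.var .m) ;;
      .put .letter (.var .m) (.var .b) ;;
      .set .m (.bin .add (.var .m) (.lit 1)))
    .skip ;;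
  .set .c (.get .child (.var .b))

/-- Let the pair `p` belong to the trie node `c`. -/
def classify : Cmd :=
  .put .cls (.var .p) (.bin .add (.var .c) (.lit 1)) ;;
  .put .next (.var .p) (.get .head (.var .c)) ;;
  .put .head (.var .c) (.bin .add (.var .p) (.lit 1))

/-- Insert the pair `p` of the nodes `x` and `z`, where `z` comes after `y`. -/
def insertPair : Cmd :=
  .set .b (.get .adjRank (.bin .sub (.var .e) (.lit 1))) ;;
  findChild ;;
  classify ;;
  .ite .eq (.var .x) (.var .y) (.put .first (.var .p) (.var .z))
    (.put .first (.var .p) (.get .first (.bin .sub (.var .q) (.lit 1))))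

/-- Extend the path from `x` to `y` by the edge `e`. -/
def visitEdge : Cmd :=
  .set .z (.get .adjNode (.bin .sub (.var .e) (.lit 1))) ;;
  .set .p (.bin .add (.bin .mul (.var .x) (.var .n)) (.var .z)) ;;
  .ite .eq (.get .cls (.var .p)) (.lit 0) insertPair .skip ;;
  .set .e (.get .adjNext (.bin .sub (.var .e) (.lit 1)))

/-- Extend the path with the number `q - 1` in all possible ways. -/
def visitPair : Cmd :=
  .set .x (.bin .div (.bin .sub (.var .q) (.lit 1)) (.var .n)) ;;
  .set .y (.bin .mod (.bin .sub (.var .q) (.lit 1)) (.var .n)) ;;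
  .set .e (.get .adjHead (.var .y)) ;;
  .loop .ne (.var .e) (.lit 0) visitEdge ;;
  .set .q (.get .next (.bin .sub (.var .q) (.lit 1)))

/-- Make all children of the trie node `v`. -/
def visitNode : Cmd :=
  .put .start (.var .v) (.var .m) ;;
  .set .q (.get .head (.var .v)) ;;
  .loop .ne (.var .q) (.lit 0) visitPair ;;
  .set .v (.bin .add (.var .v) (.lit 1))

/-- Make the root of the trie, to which the pairs of equal nodes belong. -/
def makeRoot : Cmd :=
  .set .m (.lit 1) ;;
  .set .c (.lit 0) ;;
  .set .x (.lit 0) ;;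
  .loop .lt (.var .x) (.var .n)
    (.set .p (.bin .add (.bin .mul (.var .x) (.var .n)) (.var .x)) ;;
      classify ;;
      .set .x (.bin .add (.var .x) (.lit 1)))

/-- Build the trie. -/
def buildTrie : Cmd :=
  makeRoot ;;
  .set .v (.lit 0) ;;
  .loop .lt (.var .v) (.var .m) visitNode ;;
  .put .start (.var .v) (.var .m)

variable {n σ : ℕ}

/-- The state while the trie is built: all nodes before `v` have been processed. -/
structure TrieState (Γ : Ctx) (T : UnrootedTree n σ) (D : Fin n → List ℕ) (s : Env) (v : ℕ)
    (start : ℕ → ℕ) (W : ℕ → List ℕ) (par : ℕ → ℕ) (Ls : ℕ → List (Fin n × Fin n)) : Prop where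
  var_n : s.var .n = n
  var_v : s.var .v = v
  adj : AdjLists T Γ.lam (s.arr .adjHead) (s.arr .adjNext) (s.arr .adjNode) (s.arr .adjRank)
    (2 * (n - 1)) {p | T.graph.Adj p.1 p.2} D
  nodes : TrieNodes Γ.lam n v (s.var .m) start (s.arr .letter) (s.arr .child) W par
  pairs : PairClasses T (s.var .m) (s.arr .cls) (s.arr .first) (s.arr .head) (s.arr .next) W Ls
  nonempty : ∀ c < s.var .m, Ls c ≠ []
  out : s.out = []
  mark : s.arr .mark = 0

/-- The state while the trie node `v` is processed: the pairs in `P` are done, and the pairs in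
the list `l` remain to be done. -/
structure NodeState (Γ : Ctx) (T : UnrootedTree n σ) (D : Fin n → List ℕ) (s : Env) (v : ℕ)
    (start : ℕ → ℕ) (W : ℕ → List ℕ) (par : ℕ → ℕ) (Ls : ℕ → List (Fin n × Fin n))
    (P : Finset (Fin n × Fin n)) (l : List (Fin n × Fin n)) : Prop
    extends TrieState Γ T D s v start W par Ls where
  start_eq : ∀ c ≤ v, s.arr .start c = start c
  lt : v < s.var .m
  lt_start : v < start v
  linked : IsLinked (s.arr .next) (s.var .q) (l.map pairIdx)
  mem : ∀ p ∈ l, s.arr .cls (pairIdx p) = v + 1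
  nodup : l.Nodup
  disjoint : ∀ p ∈ P, p ∉ l
  done : ∀ p ∈ P, s.arr .cls (pairIdx p) ≠ 0 ∧ s.arr .cls (pairIdx p) ≤ v + 1
  cover : ∀ p : Fin n × Fin n, s.arr .cls (pairIdx p) ≠ 0 → s.arr .cls (pairIdx p) ≤ v + 1 →
    p ∈ P ∨ p ∈ l
  closed : ∀ p ∈ P, ∀ z, T.graph.Adj p.2 z → s.arr .cls (pairIdx (p.1, z)) ≠ 0

section

variable {Γ : Ctx} {T : UnrootedTree n σ} {es : List T.graph.Dart} {Q : Env → Prop}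
  {s : Env} {D : Fin n → List ℕ} {v : ℕ} {start : ℕ → ℕ} {W : ℕ → List ℕ} {par : ℕ → ℕ}
  {Ls : ℕ → List (Fin n × Fin n)} {P : Finset (Fin n × Fin n)} {l : List (Fin n × Fin n)}

/-- A freshly made node has no pair yet, so the nonemptiness of classes is broken at `c` for a
moment. The clause on `k ≠ s'.var .c` records that it can fail nowhere else; the subsequent
insertion repairs it. -/
theorem findChild_wp (hΓ : Γ.Encodes T es) (h : NodeState Γ T D s v start W par Ls P l) {b : ℕ}
    (hb : s.var .b = b) (hbn : b + 1 < n) (hrank : IsRank Γ.lam b)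
    (hQ : ∀ (s' : Env) (W' : ℕ → List ℕ) (par' : ℕ → ℕ),
      (∀ A, A ≠ .child → A ≠ .letter → s'.arr A = s.arr A) →
      (∀ a, a ≠ .m → a ≠ .c → s'.var a = s.var a) → s'.out = s.out → s'.time ≤ s.time + 60 →
      TrieNodes Γ.lam n v (s'.var .m) start (s'.arr .letter) (s'.arr .child) W' par' →
      PairClasses T (s'.var .m) (s.arr .cls) (s.arr .first) (s.arr .head) (s.arr .next) W' Ls →
      (∀ k < s'.var .m, k ≠ s'.var .c → k < s.var .m) → s'.var .c < s'.var .m →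
      start v ≤ s'.var .c → s'.var .c ≤ n * n → v < s'.var .m →
      W' (s'.var .c) = W v ++ [Γ.lam b] → W' v = W v → Q s') :
    findChild.wp Γ Q s := by
  have hl := hΓ.len
  have hbd := hΓ.bound
  have hm := h.pairs.le_mul h.nonempty
  have hvv := h.var_v
  have hlt := h.lt
  have hst := h.start_eq v le_rfl
  have hsm := h.nodes.start_le v le_rfl
  simp only [findChild, Cmd.wp]
  refine ⟨by simp; omega, by simp; omega, fun hc => ?_, fun hc => ?_⟩
  · simp [hb, hvv, hst] at hc
    refine ⟨by simp, by simp; omega, by simp, by simp, by simp; omega, by simp,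
      by simp; omega, by simp; omega, ?_⟩
    have hT := h.nodes.addChild hlt hrank hbn hc
    refine hQ _ _ _ ?_ ?_ (by simp) (by simp) (by simpa [hb] using hT)
      (by simpa using h.pairs.mono _) ?_ (by simp) (by simpa [hb] using hsm) (by simpa [hb] using hm)
      (by simp; omega) (by simp [hb]) (Function.update_of_ne (by omega) _ _)
    · intro A h1 h2
      simp [h1, h2]
    · intro a h1 h2
      simp [h1, h2]
    · intro k hk hkc
      simp [hb] at hk hkc
      omega
  · simp [hb, hvv, hst] at hc
    have hcm := h.nodes.child_lt b
    refine ⟨by simp; omega, hQ _ _ _ ?_ ?_ (by simp) (by simp) (by simpa using h.nodes)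
      (by simpa using h.pairs) ?_ (by simpa [hb] using hcm) (by simpa [hb] using hc) ?_
      (by simpa using hlt) (by simpa [hb] using h.nodes.word_child hc) rfl⟩
    · intro A h1 h2
      simp
    · intro a h1 h2
      simp [h2]
    · intro k hk hkc
      simpa using hk
    · simp [hb]
      omega

theorem insertPair_wp (hΓ : Γ.Encodes T es) (h : NodeState Γ T D s v start W par Ls P l)
    {x y z : Fin n} {d : ℕ} (hx : s.var .x = x) (hy : s.var .y = y) (hz : s.var .z = z)
    (hp : s.var .p = pairIdx (x, z)) (hq : s.var .q = pairIdx (x, y) + 1) (he : s.var .e = d + 1)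
    (hd : d ∈ D y) (hdz : s.arr .adjNode d = z) (hxy : s.arr .cls (pairIdx (x, y)) = v + 1)
    (hxz : s.arr .cls (pairIdx (x, z)) = 0) :
    insertPair.wp Γ (fun s' => (∃ W' par' Ls', NodeState Γ T D s' v start W' par' Ls' P l) ∧
      (∀ p, s.arr .cls p ≠ 0 → s'.arr .cls p ≠ 0) ∧ s'.arr .cls (pairIdx (x, z)) ≠ 0 ∧
      s'.arr .adjNext = s.arr .adjNext ∧ s'.arr .adjNode = s.arr .adjNode ∧
      s'.var .x = s.var .x ∧ s'.var .y = s.var .y ∧ s'.var .q = s.var .q ∧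
      s'.var .e = s.var .e ∧ s'.time ≤ s.time + 150) s := by
  have hl := hΓ.len
  have hbd := hΓ.bound
  have hdlt := h.adj.lt y d hd
  obtain ⟨z', hz', hyz, hlam, hrank, hrn⟩ := h.adj.adj y d hd
  obtain rfl : z = z' := Fin.ext (hdz.symm.trans hz')
  -- If `z` came before `y` on the path from `x`, prefix closure would have classified `(x, z)`
  -- already.
  have hext : T.Extends x y z := by
    rcases T.extends_or_extends x hyz with hh | hh
    · exact hh
    · exact absurd hxz (h.pairs.closed x z y hh (by omega))
  have hxyl := pairIdx_lt (x, y)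
  have hxzl := pairIdx_lt (x, z)
  have hWv := (h.pairs.word (x, y) v hxy).2
  -- The first step is the new edge itself if the old path was empty, and is inherited otherwise.
  obtain ⟨f, hff, hfs⟩ : ∃ f : Fin n, (if x = y then (z : ℕ) else
      s.arr .first (pairIdx (x, y))) = f ∧ T.FirstStep x z f := by
    by_cases e : x = y
    · subst e
      exact ⟨z, by simp, .of_adj hyz⟩
    · obtain ⟨f, h1, h2⟩ := h.pairs.firstStep x y (by omega) e
      exact ⟨f, by simp [e, h1], h2.extend hext⟩
  simp only [insertPair, Cmd.wp]
  refine ⟨by simp [he]; omega, ?_⟩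
  -- The invariant does not mention the variable `b` or the time, so its fields carry over
  -- definitionally. Reading the rank costs 9 steps and the assignment 1.
  have h' : NodeState Γ T D ((s.set .b (s.arr .adjRank d)).tick 10) v start W par Ls P l := by
    obtain ⟨⟨a1, a2, a3, a4, a5, a6, a7, a8⟩, b1, b2, b3, b4, b5, b6, b7, b8, b9, b10⟩ := h
    exact ⟨⟨a1, a2, a3, a4, a5, a6, a7, a8⟩, b1, b2, b3, b4, b5, b6, b7, b8, b9, b10⟩
  have hE : s.arr .adjRank ((s.var .e) - 1) = s.arr .adjRank d := by rw [he]; rfl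
  have hS : (s.set .b (Expr.eval Γ s (.get .adjRank (.bin .sub (.var .e) (.lit 1))))).tick
      ((Expr.get .adjRank (.bin .sub (.var .e) (.lit 1))).cost + 1) =
      (s.set .b (s.arr .adjRank d)).tick 10 := by simp [hE]
  rw [hS]
  refine findChild_wp hΓ h' (by simp) hrn hrank ?_
  intro s₁ W' par' hA hV hO ht hN hP hk hcm hcs hcn hvm hWc hWv'
  simp only [Env.tick_arr, Env.set_arr, Env.set_out, Env.tick_out] at hA hO hP
  have hV' : ∀ a, a ≠ .m → a ≠ .c → a ≠ .b → s₁.var a = s.var a := by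
    intro a h1 h2 h3
    rw [hV a h1 h2]
    simp [h3]
  have hI := hP.insert hext (by omega) hxz hcm (by rw [hWc, hlam, hext.natWord, hWv]) hfs
  have hlt := h.lt_start
  -- Both branches of the final test lead to the same array contents, so the invariant is restored
  -- once for any state with these contents.
  have key : ∀ t ≤ s.time + 150, ∀ s' : Env,
      s'.var = s₁.var → s'.out = s₁.out → s'.time = t →
      (∀ A, A ≠ .cls → A ≠ .next → A ≠ .head → A ≠ .first → s'.arr A = s₁.arr A) →
      s'.arr .cls = Function.update (s.arr .cls) (pairIdx (x, z)) (s₁.var .c + 1) →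
      s'.arr .next = Function.update (s.arr .next) (pairIdx (x, z)) (s.arr .head (s₁.var .c)) →
      s'.arr .head = Function.update (s.arr .head) (s₁.var .c) (pairIdx (x, z) + 1) →
      s'.arr .first = Function.update (s.arr .first) (pairIdx (x, z)) f →
      (∃ W' par' Ls', NodeState Γ T D s' v start W' par' Ls' P l) ∧
      (∀ p, s.arr .cls p ≠ 0 → s'.arr .cls p ≠ 0) ∧ s'.arr .cls (pairIdx (x, z)) ≠ 0 ∧
      s'.arr .adjNext = s.arr .adjNext ∧ s'.arr .adjNode = s.arr .adjNode ∧
      s'.var .x = s.var .x ∧ s'.var .y = s.var .y ∧ s'.var .q = s.var .q ∧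
      s'.var .e = s.var .e ∧ s'.time ≤ s.time + 150 := by
    intro t ht s' hv ho ht' hAA hcls hnext hhead hfirst
    have hcls1 : ∀ p, s.arr .cls p ≠ 0 → s'.arr .cls p = s.arr .cls p := by
      intro p hp
      rw [hcls, Function.update_of_ne]
      rintro rfl
      exact hp hxz
    have hcls2 : ∀ p, s.arr .cls p ≠ 0 → s'.arr .cls p ≠ 0 := by
      intro p hp
      rwa [hcls1 p hp]
    have hcls3 : s'.arr .cls (pairIdx (x, z)) = s₁.var .c + 1 := by
      rw [hcls, Function.update_self]
    have hA' : ∀ A, A ≠ .cls → A ≠ .next → A ≠ .head → A ≠ .first → A ≠ .child → A ≠ .letter →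
        s'.arr A = s.arr A := fun A h1 h2 h3 h4 h5 h6 => by
      rw [hAA A h1 h2 h3 h4, hA A h5 h6]
    have hV'' : ∀ a, a ≠ .m → a ≠ .c → a ≠ .b → s'.var a = s.var a := fun a h1 h2 h3 => by
      rw [hv, hV' a h1 h2 h3]
    refine ⟨⟨W', par', Function.update Ls (s₁.var .c) ((x, z) :: Ls (s₁.var .c)),
      ⟨⟨?_, ?_, ?_, ?_, ?_, ?_, ?_, ?_⟩, ?_, ?_, hlt, ?_, ?_, h.nodup, h.disjoint, ?_, ?_, ?_⟩⟩,
      hcls2, by omega, ?_, ?_, ?_, ?_, ?_, ?_, by omega⟩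
    · rw [hV'' .n (by simp) (by simp) (by simp), h.var_n]
    · rw [hV'' .v (by simp) (by simp) (by simp), h.var_v]
    · rw [hA' .adjHead (by simp) (by simp) (by simp) (by simp) (by simp) (by simp),
        hA' .adjNext (by simp) (by simp) (by simp) (by simp) (by simp) (by simp),
        hA' .adjNode (by simp) (by simp) (by simp) (by simp) (by simp) (by simp),
        hA' .adjRank (by simp) (by simp) (by simp) (by simp) (by simp) (by simp)]
      exact h.adj
    · rw [hv, hAA .letter (by simp) (by simp) (by simp) (by simp),
        hAA .child (by simp) (by simp) (by simp) (by simp)]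
      exact hN
    · rw [hv, hcls, hfirst, hhead, hnext]
      exact hI
    · intro k hk'
      by_cases e : k = s₁.var .c
      · subst e; simp
      · rw [Function.update_of_ne e]
        exact h.nonempty k (hk k (by rwa [hv] at hk') e)
    · rw [ho, hO, h.out]
    · rw [hA' .mark (by simp) (by simp) (by simp) (by simp) (by simp) (by simp), h.mark]
    · rw [hA' .start (by simp) (by simp) (by simp) (by simp) (by simp) (by simp)]
      exact h.start_eq
    · rw [hv]; exact hvm
    -- The overwritten pointer belongs to `(x, z)`, which was unclassified and hence is not among
    -- the remaining pairs of `v`.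
    · rw [hnext, hV'' .q (by simp) (by simp) (by simp)]
      refine h.linked.update fun hmem => ?_
      rw [List.mem_map_of_injective pairIdx_injective] at hmem
      have := h.mem _ hmem
      omega
    · intro p hp
      have := h.mem p hp
      rw [hcls1 _ (by omega), this]
    · intro p hp
      have := h.done p hp
      rwa [hcls1 _ this.1]
    -- The new pair goes to a node numbered at least `start v > v`, so it adds no work to the node
    -- being processed.
    · intro p h0 hle
      by_cases e : p = (x, z)
      · subst e
        omega
      · rw [hcls, Function.update_of_ne (pairIdx_injective.ne e)] at h0 hle
        exact h.cover p h0 hle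
    · intro p hp z' hz'
      exact hcls2 _ (h.closed p hp z' hz')
    · rw [hA' .adjNext (by simp) (by simp) (by simp) (by simp) (by simp) (by simp)]
    · rw [hA' .adjNode (by simp) (by simp) (by simp) (by simp) (by simp) (by simp)]
    all_goals exact hV'' _ (by simp) (by simp) (by simp)
  have e1 : s₁.var .p = pairIdx (x, z) := by rw [hV' _ (by simp) (by simp) (by simp), hp]
  have e2 : s₁.var .q = pairIdx (x, y) + 1 := by rw [hV' _ (by simp) (by simp) (by simp), hq]
  have e3 : s₁.var .x = x := by rw [hV' _ (by simp) (by simp) (by simp), hx]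
  have e4 : s₁.var .y = y := by rw [hV' _ (by simp) (by simp) (by simp), hy]
  have e5 : s₁.var .z = z := by rw [hV' _ (by simp) (by simp) (by simp), hz]
  simp only [Env.tick_time, Env.set_time] at ht
  simp only [classify, Cmd.wp]
  refine ⟨by simp, by simp; omega, by simp; omega, by simp, by simp; omega, by simp; omega,
    by simp, by simp; omega, by simp; omega, by simp, by simp, fun hc => ?_, fun hc => ?_⟩
  · simp [e3, e4, Fin.val_inj] at hc
    subst hc
    refine ⟨by simp, by simp; omega, by simp, key _ ?_ _ (by simp) (by simp) rfl ?_ ?_ ?_ ?_ ?_⟩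
    · simp; omega
    · intro A h1 h2 h3 h4
      simp [h1, h2, h3, h4]
    · simp [e1, hA]
    · simp [e1, hA]
    · simp [e1, hA]
    · simp at hff
      simp [e1, e5, hA, hff]
  · simp [e3, e4, Fin.val_inj] at hc
    refine ⟨by simp, by simp; omega, by simp; omega,
      key _ ?_ _ (by simp) (by simp) rfl ?_ ?_ ?_ ?_ ?_⟩
    · simp; omega
    · intro A h1 h2 h3 h4
      simp [h1, h2, h3, h4]
    · simp [e1, hA]
    · simp [e1, hA]
    · simp [e1, hA]
    · simp [hc] at hff
      simp [e1, e2, hA, hff]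

theorem visitEdge_wp (hΓ : Γ.Encodes T es) (h : NodeState Γ T D s v start W par Ls P l)
    {x y : Fin n} {d : ℕ} (hx : s.var .x = x) (hy : s.var .y = y)
    (hq : s.var .q = pairIdx (x, y) + 1) (he : s.var .e = d + 1) (hd : d ∈ D y)
    (hxy : s.arr .cls (pairIdx (x, y)) = v + 1) :
    visitEdge.wp Γ (fun s' => (∃ W' par' Ls', NodeState Γ T D s' v start W' par' Ls' P l) ∧
      (∀ p, s.arr .cls p ≠ 0 → s'.arr .cls p ≠ 0) ∧
      (∀ z : Fin n, s.arr .adjNode d = z → s'.arr .cls (pairIdx (x, z)) ≠ 0) ∧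
      s'.arr .adjNext = s.arr .adjNext ∧ s'.arr .adjNode = s.arr .adjNode ∧
      s'.var .x = s.var .x ∧ s'.var .y = s.var .y ∧ s'.var .q = s.var .q ∧
      s'.var .e = s.arr .adjNext d ∧ s'.time ≤ s.time + 220) s := by
  have hl := hΓ.len
  have hbd := hΓ.bound
  have hdlt := h.adj.lt y d hd
  have hn := h.var_n
  obtain ⟨z, hz, hyz, -⟩ := h.adj.adj y d hd
  have hxzl := pairIdx_lt (x, z)
  have hxn : (x : ℕ) * n + z = pairIdx (x, z) := rfl
  simp only [visitEdge, Cmd.wp]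
  have hE : s.arr .adjNode (s.var .e - 1) = z := by rw [he]; exact hz
  refine ⟨by simp; omega, ?_, ?_⟩
  · simp [hx, hn, hE, hxn]
    omega
  simp only [Expr.eval, Env.tick_var, Env.set_var, NatOp.eval, Env.tick_set, Env.tick_tick,
    Function.update_self, ne_eq, reduceCtorEq, not_false_eq_true, Function.update_of_ne,
    Env.tick_arr, Env.set_arr, hx, hn, hE, hxn]
  refine ⟨by simp; omega, by simp; omega, fun hc => ?_, fun hc => ?_⟩
  · simp only [Cmp.Test] at hc
    refine Cmd.wp_mono ?_ (insertPair_wp hΓ (W := W) (par := par) (Ls := Ls) (P := P) (l := l)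
      (v := v) (start := start) (D := D) ?_ (x := x) (y := y) (z := z) (d := d) (by simp [hx])
      (by simp [hy]) (by simp) (by simp) (by simp [hq]) (by simp [he]) hd (by simp [hz])
      (by simpa using hxy) (by simpa using hc))
    · rintro s' ⟨⟨W', par', Ls', hN⟩, a1, a2, a3, a4, a5, a6, a7, a8, a9⟩
      simp at a1 a2 a3 a4 a5 a6 a7 a8 a9
      have hE' : s'.arr .adjNext (s'.var .e - 1) = s.arr .adjNext d := by
        rw [a8, he, a3]; rfl
      refine ⟨by simp; omega, ⟨W', par', Ls', ?_⟩, by simpa using a1, ?_, by simpa using a3,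
        by simpa using a4, by simp [a5, hx], by simpa using a6, by simpa using a7, ?_, ?_⟩
      · obtain ⟨⟨a1, a2, a3, a4, a5, a6, a7, a8⟩, b1, b2, b3, b4, b5, b6, b7, b8, b9, b10⟩ := hN
        exact ⟨⟨a1, a2, a3, a4, a5, a6, a7, a8⟩, b1, b2, b3, b4, b5, b6, b7, b8, b9, b10⟩
      · intro z' hz'
        obtain rfl : z = z' := Fin.ext (hz.symm.trans hz')
        simpa using a2
      · simp [hE']
      · simp; omega
    · obtain ⟨⟨a1, a2, a3, a4, a5, a6, a7, a8⟩, b1, b2, b3, b4, b5, b6, b7, b8, b9, b10⟩ := h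
      exact ⟨⟨a1, a2, a3, a4, a5, a6, a7, a8⟩, b1, b2, b3, b4, b5, b6, b7, b8, b9, b10⟩
  · simp only [Cmp.Test] at hc
    have hE' : s.arr .adjNext (s.var .e - 1) = s.arr .adjNext d := by
      rw [he]; rfl
    refine ⟨by simp; omega, ⟨W, par, Ls, ?_⟩, by simp, ?_, by simp, by simp, by simp, by simp,
      by simp, by simp [hE'], by simp⟩
    · obtain ⟨⟨a1, a2, a3, a4, a5, a6, a7, a8⟩, b1, b2, b3, b4, b5, b6, b7, b8, b9, b10⟩ := h
      exact ⟨⟨a1, a2, a3, a4, a5, a6, a7, a8⟩, b1, b2, b3, b4, b5, b6, b7, b8, b9, b10⟩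
    · intro z' hz'
      obtain rfl : z = z' := Fin.ext (hz.symm.trans hz')
      simpa using hc

/-- The invariant carries the list `ds` of adjacency cells still to be visited: each neighbour of
`y` either has its pair classified or occurs in `ds`. When `ds` is empty, all extensions are
classified. -/
theorem visitPair_wp (hΓ : Γ.Encodes T es) {x y : Fin n}
    (h : NodeState Γ T D s v start W par Ls P ((x, y) :: l)) :
    visitPair.wp Γ (fun s' => (∃ W' par' Ls',
      NodeState Γ T D s' v start W' par' Ls' (insert (x, y) P) l) ∧
      s'.time ≤ s.time + 60 + 230 * (D y).length) s := by
  have hl := hΓ.len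
  have hbd := hΓ.bound
  have hq := h.linked.1
  have hn := h.var_n
  have hxyl := pairIdx_lt (x, y)
  have hyn := y.isLt
  have hnn : n ≤ n * n := Nat.le_mul_self n
  simp only [visitPair, Cmd.wp_seq, Cmd.wp_set]
  have hE1 : (s.var .q - 1) / n = x := by rw [hq]; exact pairIdx_div (x, y)
  have hE2 : (s.var .q - 1) % n = y := by rw [hq]; exact pairIdx_mod (x, y)
  simp only [Expr.eval, Env.tick_var, Env.set_var, NatOp.eval, Env.tick_set, Env.tick_tick,
    Function.update_self, ne_eq, reduceCtorEq, not_false_eq_true, Function.update_of_ne,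
    Env.tick_arr, Env.set_arr, hn, hE1, hE2]
  refine ⟨by simp; omega, by simp; omega, by simp; omega, Cmd.loop_wp
    (fun k s' => ∃ W par Ls ds, NodeState Γ T D s' v start W par Ls P ((x, y) :: l) ∧
      s'.var .x = x ∧ s'.var .y = y ∧ IsLinked (s'.arr .adjNext) (s'.var .e) ds ∧
      (∀ d ∈ ds, d ∈ D y) ∧ ds.length = k ∧
      (∀ z, T.graph.Adj y z → s'.arr .cls (pairIdx (x, z)) ≠ 0 ∨ ∃ d ∈ ds, s'.arr .adjNode d = z) ∧
      s'.time + 230 * k ≤ s.time + 40 + 230 * (D y).length) (k := (D y).length) ?_ ?_⟩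
  · refine ⟨W, par, Ls, D y, ?_, by simp, by simp, by simpa using h.adj.linked y, by simp, rfl, ?_,
      by simp⟩
    · obtain ⟨⟨a1, a2, a3, a4, a5, a6, a7, a8⟩, b1, b2, b3, b4, b5, b6, b7, b8, b9, b10⟩ := h
      exact ⟨⟨a1, a2, a3, a4, a5, a6, a7, a8⟩, b1, b2, b3, b4, b5, b6, b7, b8, b9, b10⟩
    · intro z hz
      exact Or.inr (h.adj.cover (y, z) hz)
  · rintro k s' ⟨W', par', Ls', ds, hN, hx, hy, hds, hdD, hk, hz, ht⟩
    have hq' := hN.linked.1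
    refine ⟨by simp, by simp; omega, fun hc => ?_, fun hc => ?_⟩
    · simp at hc
      obtain _ | ⟨d, ds⟩ := ds
      · exact absurd hds hc
      obtain ⟨he, hds⟩ := hds
      have hcls := hN.mem (x, y) (by simp)
      refine Cmd.wp_mono ?_ (visitEdge_wp hΓ (s := s'.tick _) (W := W') (par := par') (Ls := Ls')
        (P := P) (l := (x, y) :: l) (v := v) (start := start) (D := D) ?_ (x := x) (y := y) (d := d)
        (by simpa using hx) (by simpa using hy) (by simpa using hq') (by simpa using he)
        (hdD d (by simp)) (by simpa using hcls))
      · rintro s'' ⟨⟨W'', par'', Ls'', hN''⟩, a1, a2, a3, a4, a5, a6, a7, a8, a9⟩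
        simp at a1 a2 a3 a4 a5 a6 a7 a8 a9
        simp at hk
        refine ⟨ds.length, by omega, W'', par'', Ls'', ds, hN'', by omega, by omega,
          by rwa [a3, a8], fun d hd => hdD d (by simp [hd]), rfl, ?_, by omega⟩
        intro z hyz
        rcases hz z hyz with h1 | ⟨d', hd', h1⟩
        · exact Or.inl (a1 _ h1)
        · rcases List.mem_cons.1 hd' with rfl | hd'
          · exact Or.inl (a2 z h1)
          · exact Or.inr ⟨d', hd', by rw [a4, h1]⟩
      · obtain ⟨⟨a1, a2, a3, a4, a5, a6, a7, a8⟩, b1, b2, b3, b4, b5, b6, b7, b8, b9, b10⟩ := hN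
        exact ⟨⟨a1, a2, a3, a4, a5, a6, a7, a8⟩, b1, b2, b3, b4, b5, b6, b7, b8, b9, b10⟩
    · simp at hc
      obtain _ | ⟨d, ds⟩ := ds
      swap
      · have := hds.1
        omega
      have hE : s'.arr .next (s'.var .q - 1) = s'.arr .next (pairIdx (x, y)) := by
        rw [hq']; rfl
      have hcls := hN.mem (x, y) (by simp)
      refine ⟨by simp; omega, ⟨W', par', Ls', ⟨⟨hN.var_n, hN.var_v, hN.adj, hN.nodes, hN.pairs,
        hN.nonempty, hN.out, hN.mark⟩, hN.start_eq, hN.lt, hN.lt_start, ?_, ?_, ?_, ?_, ?_, ?_, ?_⟩⟩,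
        by simp; omega⟩
      · simpa [hE] using hN.linked.2
      · exact fun p hp => hN.mem p (by simp [hp])
      · exact (List.nodup_cons.1 hN.nodup).2
      · intro p hp hpl
        rcases Finset.mem_insert.1 hp with rfl | hp
        · exact (List.nodup_cons.1 hN.nodup).1 hpl
        · exact hN.disjoint p hp (by simp [hpl])
      · intro p hp
        rcases Finset.mem_insert.1 hp with rfl | hp
        · simp [hcls]
        · exact hN.done p hp
      · intro p h0 hle
        rcases hN.cover p h0 hle with hp | hp
        · exact Or.inl (by simp [hp])
        · rcases List.mem_cons.1 hp with rfl | hp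
          · exact Or.inl (by simp)
          · exact Or.inr hp
      · intro p hp z hpz
        rcases Finset.mem_insert.1 hp with rfl | hp
        · rcases hz z hpz with h1 | ⟨d, hd, -⟩
          · exact h1
          · simp at hd
        · exact hN.closed p hp z hpz

/-- The time that is allotted to the visit of a pair. -/
def visitTime (D : Fin n → List ℕ) (p : Fin n × Fin n) : ℕ := 70 + 230 * (D p.2).length

/-- For fixed `x` the adjacency lists of all `y` together have `k` cells. Since `k` is linear in `n`
in the application, the bound is quadratic. -/
theorem sum_visitTime_le {lam head next node rank : ℕ → ℕ} {k : ℕ} {E : Set (Fin n × Fin n)}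
    (h : AdjLists T lam head next node rank k E D) (P : Finset (Fin n × Fin n)) :
    ∑ p ∈ P, visitTime D p ≤ 70 * (n * n) + 230 * (n * k) := by
  calc ∑ p ∈ P, visitTime D p ≤ ∑ p, visitTime D p :=
        Finset.sum_le_sum_of_subset (Finset.subset_univ P)
    _ = 70 * (n * n) + 230 * (n * k) := by
      simp only [visitTime, Finset.sum_add_distrib, ← Finset.mul_sum, Fintype.sum_prod_type,
        h.total]
      simp
      ring

/-- The state before the trie node `v` is processed: the pairs in `P` are done. -/
structure HeadState (Γ : Ctx) (T : UnrootedTree n σ) (D : Fin n → List ℕ) (s : Env) (v : ℕ)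
    (start : ℕ → ℕ) (W : ℕ → List ℕ) (par : ℕ → ℕ) (Ls : ℕ → List (Fin n × Fin n))
    (P : Finset (Fin n × Fin n)) : Prop
    extends TrieState Γ T D s v start W par Ls where
  start_eq : ∀ c < v, s.arr .start c = start c
  start_self : start v = s.var .m
  le : v ≤ s.var .m
  done : ∀ p, p ∈ P ↔ s.arr .cls (pairIdx p) ≠ 0 ∧ s.arr .cls (pairIdx p) ≤ v
  closed : ∀ p ∈ P, ∀ z, T.graph.Adj p.2 z → s.arr .cls (pairIdx (p.1, z)) ≠ 0

/-- The time is charged to the pairs that become done, not bounded per node; summed over all nodes,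
every pair is paid for once. -/
theorem visitNode_wp (hΓ : Γ.Encodes T es) (h : HeadState Γ T D s v start W par Ls P)
    (hv : v < s.var .m) :
    visitNode.wp Γ (fun s' => ∃ start' W' par' Ls' P',
      HeadState Γ T D s' (v + 1) start' W' par' Ls' P' ∧
      s'.time + ∑ p ∈ P, visitTime D p ≤ s.time + 30 + ∑ p ∈ P', visitTime D p) s := by
  have hl := hΓ.len
  have hbd := hΓ.bound
  have hvv := h.var_v
  have hm := h.pairs.le_mul h.nonempty
  simp only [visitNode, Cmd.wp_seq, Cmd.wp_set, Cmd.wp_put]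
  refine ⟨by simp, by simp; omega, by simp, by simp; omega, Cmd.loop_wp
    (fun k s' => ∃ W par Ls P' l, NodeState Γ T D s' v start W par Ls P' l ∧ l.length = k ∧
      s'.time + ∑ p ∈ P, visitTime D p ≤ s.time + 20 + ∑ p ∈ P', visitTime D p)
      (k := (Ls v).length) ?_ ?_⟩
  · refine ⟨W, par, Ls, P, Ls v, ⟨⟨h.var_n, h.var_v, h.adj, h.nodes, h.pairs, h.nonempty, h.out,
      h.mark⟩, ?_, hv, ?_, ?_, ?_, h.pairs.nodup v, ?_, ?_, ?_, ?_⟩, rfl, ?_⟩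
    · intro c hc
      rcases Nat.lt_or_eq_of_le hc with hc | rfl
      · simp [hvv, hc.ne, h.start_eq c hc]
      · simp [hvv, h.start_self]
    · rw [h.start_self]; exact hv
    · simpa [hvv] using h.pairs.linked v
    · exact fun p hp => (h.pairs.mem v p).1 hp
    · intro p hp hp'
      have h1 := (h.done p).1 hp
      have h2 := (h.pairs.mem v p).1 hp'
      omega
    · intro p hp
      have h1 := (h.done p).1 hp
      exact ⟨h1.1, h1.2.trans (Nat.le_succ v)⟩
    · intro p h0 hle
      rcases Nat.lt_succ_iff_lt_or_eq.1 (Nat.lt_succ_of_le hle) with h1 | h1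
      · exact Or.inl ((h.done p).2 ⟨h0, Nat.le_of_lt_succ h1⟩)
      · exact Or.inr ((h.pairs.mem v p).2 h1)
    · exact h.closed
    · simp
  · rintro k s' ⟨W', par', Ls', P', l, hN, hk, ht⟩
    refine ⟨by simp, by simp; omega, fun hc => ?_, fun hc => ?_⟩
    · simp at hc
      obtain _ | ⟨⟨x, y⟩, l⟩ := l
      · exact absurd hN.linked hc
      simp at hk
      refine Cmd.wp_mono ?_ (visitPair_wp hΓ (x := x) (y := y) (l := l) (s := s'.tick _) (W := W')
        (par := par') (Ls := Ls') (P := P') (v := v) (start := start) (D := D) ?_)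
      · rintro s'' ⟨⟨W'', par'', Ls'', hN''⟩, ht''⟩
        refine ⟨l.length, by omega, W'', par'', Ls'', _, l, hN'', rfl, ?_⟩
        rw [Finset.sum_insert (fun hP => hN.disjoint _ hP (by simp)), visitTime]
        simp at ht''
        simp only
        omega
      · obtain ⟨⟨a1, a2, a3, a4, a5, a6, a7, a8⟩, b1, b2, b3, b4, b5, b6, b7, b8, b9, b10⟩ := hN
        exact ⟨⟨a1, a2, a3, a4, a5, a6, a7, a8⟩, b1, b2, b3, b4, b5, b6, b7, b8, b9, b10⟩
    · simp at hc
      obtain _ | ⟨p, l⟩ := l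
      swap
      · have := hN.linked.1
        omega
      have hm' := hN.pairs.le_mul hN.nonempty
      have hvv' := hN.var_v
      have hlt := hN.lt
      refine ⟨by simp; omega, Function.update start (v + 1) (s'.var .m), W', par', Ls', P',
        ⟨⟨hN.var_n, ?_, hN.adj, ?_, hN.pairs,
        hN.nonempty, hN.out, hN.mark⟩, ?_, ?_, ?_, ?_, hN.closed⟩, ?_⟩
      · simp [hvv']
      · exact hN.nodes.next
      · intro c hc
        rw [Function.update_of_ne (by omega)]
        exact hN.start_eq c (by omega)
      · simp
      · exact hlt
      · refine fun p => ⟨hN.done p, fun hp => ?_⟩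
        simpa using hN.cover p hp.1 hp.2
      · simp; omega

theorem makeRoot_wp (hΓ : Γ.Encodes T es) (hn : s.var .n = n) (hf : s.Fresh)
    (h : AdjLists T Γ.lam (s.arr .adjHead) (s.arr .adjNext) (s.arr .adjNode) (s.arr .adjRank)
      (2 * (n - 1)) {p | T.graph.Adj p.1 p.2} D)
    (hQ : ∀ s' : Env, s'.var .n = n → s'.var .m = 1 →
      (∀ A, A ≠ .cls → A ≠ .next → A ≠ .head → s'.arr A = s.arr A) → s'.out = [] →
      s'.time ≤ s.time + 70 * n + 10 → (∀ p : Fin n × Fin n,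
        s'.arr .cls (pairIdx p) = if p.1 = p.2 then 1 else 0) →
      (∀ c, c ≠ 0 → s'.arr .head c = 0) →
      (∃ L : List (Fin n), L.Nodup ∧ (∀ x, x ∈ L) ∧
        IsLinked (s'.arr .next) (s'.arr .head 0) (L.map fun x => pairIdx (x, x))) → Q s') :
    makeRoot.wp Γ Q s := by
  have hl := hΓ.len
  have hbd := hΓ.bound
  have hlen := hΓ.length
  have hnn : n ≤ n * n := Nat.le_mul_self n
  obtain ⟨ho, hcls, hnext, hhead, -⟩ := hf
  simp only [makeRoot, Cmd.wp_seq, Cmd.wp_set]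
  refine ⟨by simp; omega, by simp; omega, by simp; omega, Cmd.loop_wp
    (fun k s' => ∃ i, k + i = n ∧ s'.var .n = n ∧ s'.var .m = 1 ∧ s'.var .c = 0 ∧ s'.var .x = i ∧
      (∀ A, A ≠ .cls → A ≠ .next → A ≠ .head → s'.arr A = s.arr A) ∧ s'.out = [] ∧
      s'.time ≤ s.time + 70 * i + 6 ∧ (∀ p : Fin n × Fin n,
        s'.arr .cls (pairIdx p) = if p.1 = p.2 ∧ p.1 < i then 1 else 0) ∧
      (∀ c, c ≠ 0 → s'.arr .head c = 0) ∧
      (∃ L : List (Fin n), L.Nodup ∧ (∀ x, x ∈ L ↔ x < i) ∧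
        IsLinked (s'.arr .next) (s'.arr .head 0) (L.map fun x => pairIdx (x, x))))
    (k := n) ?_ ?_⟩
  · refine ⟨0, by simp, by simp [hn], by simp, by simp, by simp, by simp, by simp [ho], by simp,
      by simp [hcls], by simp [hhead], [], by simp, by simp, ?_⟩
    simp [IsLinked, hhead]
  · rintro k s' ⟨i, hki, hn', hm', hc', hx', hA, ho', ht, hcl, hhd, L, hL, hmem, hlink⟩
    refine ⟨by simp, by simp, fun hc => ?_, fun hc => ?_⟩
    · simp [hx', hn'] at hc
      have hi := pairIdx_lt ((⟨i, hc⟩, ⟨i, hc⟩) : Fin n × Fin n)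
      have hi' : pairIdx ((⟨i, hc⟩, ⟨i, hc⟩) : Fin n × Fin n) = i * n + i := rfl
      have hnot : (⟨i, hc⟩ : Fin n) ∉ L := fun h => absurd ((hmem _).1 h) (lt_irrefl i)
      simp only [classify, Cmd.wp_seq, Cmd.wp_set, Cmd.wp_put]
      refine ⟨by simp [hx', hn']; omega, by simp, by simp [hx', hn']; omega, by simp [hc']; omega,
        by simp, by simp [hx', hn']; omega, by simp [hc']; omega, by simp, by simp [hc']; omega,
        by simp [hx', hn']; omega, by simp [hx']; omega, k - 1, by omega, i + 1, by omega,
        by simp [hn'], by simp [hm'], by simp [hc'], by simp [hx'], ?_, by simp [ho'], ?_, ?_, ?_,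
        ⟨i, hc⟩ :: L, List.nodup_cons.2 ⟨hnot, hL⟩, ?_, ?_⟩
      · intro A h1 h2 h3
        simp [h1, h2, h3, hA A h1 h2 h3]
      · simp; omega
      · intro p
        simp only [Env.tick_arr, Env.set_arr, Env.put_arr, ne_eq, reduceCtorEq, not_false_eq_true,
          Function.update_of_ne, Function.update_self, Env.tick_var, Env.set_var, Expr.eval,
          NatOp.eval, hx', hn', hc', ← hi']
        by_cases e : p = (⟨i, hc⟩, ⟨i, hc⟩)
        · subst e; simp
        · rw [Function.update_of_ne (pairIdx_injective.ne e), hcl]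
          have : (p.1 = p.2 ∧ (p.1 : ℕ) < i) ↔ (p.1 = p.2 ∧ (p.1 : ℕ) < i + 1) := by
            refine and_congr_right fun h12 => ⟨fun h => by omega, fun h => ?_⟩
            rcases Nat.lt_succ_iff_lt_or_eq.1 h with h | h
            · exact h
            · exact absurd (Prod.ext (Fin.ext h) (Fin.ext (by rw [← h12]; exact h))) e
          simp only [this]
      · intro c h0
        simpa [hc', h0] using hhd c h0
      · intro x
        rw [List.mem_cons, hmem, Fin.ext_iff]
        simp only
        omega
      · have hnot' : pairIdx ((⟨i, hc⟩, ⟨i, hc⟩) : Fin n × Fin n) ∉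
            L.map fun x => pairIdx (x, x) := by
          intro hh
          obtain ⟨x, hx, e⟩ := List.mem_map.1 hh
          have := congrArg Prod.fst (pairIdx_injective e)
          simp only at this
          exact hnot (this ▸ hx)
        simpa [hx', hn', hc', ← hi'] using hlink.push hnot'
    · simp [hx', hn'] at hc
      obtain rfl : i = n := by omega
      refine hQ _ (by simpa using hn') (by simpa using hm') (by simpa using hA) (by simpa using ho')
        (by simp; omega) ?_ (by simpa using hhd) ⟨L, hL, fun x => (hmem x).2 x.isLt, by simpa using hlink⟩
      intro p
      simpa using hcl p

/-! ### The completed trie -/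

/-- The state in which the trie is complete. -/
structure TrieReady (Γ : Ctx) (T : UnrootedTree n σ) (s : Env) (W : ℕ → List ℕ) : Prop where
  var_n : s.var .n = n
  pos : 0 < s.var .m
  le : s.var .m ≤ n * n
  root : W 0 = []
  inj : ∀ c < s.var .m, ∀ c' < s.var .m, W c = W c' → c = c'
  word : ∀ p : Fin n × Fin n, ∃ c < s.var .m, s.arr .cls (pairIdx p) = c + 1 ∧
    W c = T.natWord p.1 p.2
  head : ∀ c < s.var .m, ∃ p : Fin n × Fin n, s.arr .head c = pairIdx p + 1 ∧
    W c = T.natWord p.1 p.2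
  start_le : ∀ c ≤ s.var .m, s.arr .start c ≤ s.var .m
  mono : ∀ c < s.var .m, s.arr .start c ≤ s.arr .start (c + 1)
  range : ∀ c < s.var .m, ∀ k, s.arr .start c ≤ k → k < s.arr .start (c + 1) →
    k < s.var .m ∧ W k = W c ++ [Γ.lam (s.arr .letter k)] ∧ IsRank Γ.lam (s.arr .letter k) ∧
    s.arr .letter k + 1 < n
  cover : ∀ k, 0 < k → k < s.var .m → ∃ c < s.var .m, s.arr .start c ≤ k ∧
    k < s.arr .start (c + 1)
  first : ∀ x y : Fin n, x ≠ y →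
    ∃ f : Fin n, s.arr .first (pairIdx (x, y)) = f ∧ T.FirstStep x y f
  out : s.out = []
  mark : s.arr .mark = 0

theorem HeadState.ready (h : HeadState Γ T D s v start W par Ls P) (hv : s.var .m = v)
    {s' : Env} (hvar : s'.var = s.var) (hout : s'.out = s.out)
    (harr : s'.arr = Function.update s.arr .start (Function.update (s.arr .start) v v)) :
    TrieReady Γ T s' W := by
  have hstart : ∀ c ≤ v, s'.arr .start c = start c := by
    intro c hc
    rw [harr, Function.update_self]
    rcases Nat.lt_or_eq_of_le hc with hc | rfl
    · rw [Function.update_of_ne hc.ne, h.start_eq c hc]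
    · rw [Function.update_self, h.start_self, hv]
  have harr' : ∀ A, A ≠ .start → s'.arr A = s.arr A := fun A hA => by
    rw [harr, Function.update_of_ne hA]
  have hcls : ∀ p : Fin n × Fin n, ∃ c < v, s.arr .cls (pairIdx p) = c + 1 ∧
      W c = T.natWord p.1 p.2 := by
    rintro ⟨x, y⟩
    have h0 : s.arr .cls (pairIdx (x, y)) ≠ 0 := by
      -- All classified pairs have been processed, since no trie node is left; their extensions by
      -- edges are classified too, and `(x, x)` is the starting point.
      refine T.of_adj_closed (S := fun y => s.arr .cls (pairIdx (x, y)) ≠ 0) x ?_ ?_ y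
      · rw [h.pairs.diag]; omega
      · intro y z hyz hy
        obtain ⟨c, hc⟩ := Nat.exists_eq_succ_of_ne_zero hy
        have := (h.pairs.word (x, y) c hc).1
        exact h.closed (x, y) ((h.done _).2 ⟨hy, by omega⟩) z hyz
    obtain ⟨c, hc⟩ := Nat.exists_eq_succ_of_ne_zero h0
    have := h.pairs.word (x, y) c hc
    exact ⟨c, by omega, hc, this.2⟩
  have hm := h.pairs.le_mul h.nonempty
  have hN := h.nodes
  rw [hv] at hN
  refine ⟨by rw [hvar, h.var_n], by rw [hvar]; exact h.nodes.pos, by rw [hvar]; exact hm,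
    hN.root, ?_, ?_, ?_, ?_, ?_, ?_, ?_, ?_, by rw [hout, h.out],
    by rw [harr' _ (by simp), h.mark]⟩ <;> (try rw [hvar, hv]) <;>
    (try rw [harr' .cls (by simp)]) <;> (try rw [harr' .first (by simp)])
  · exact hN.inj
  · exact hcls
  · intro c hc
    rw [harr' .head (by simp)]
    obtain ⟨p, l, hl⟩ := List.exists_cons_of_ne_nil (h.nonempty c (by omega))
    have h1 := h.pairs.linked c
    rw [hl] at h1
    exact ⟨p, h1.1, (h.pairs.word p c ((h.pairs.mem c p).1 (by simp [hl]))).2⟩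
  · intro c hc
    rw [hstart c hc]
    exact hN.start_le c hc
  · intro c hc
    rw [hstart c hc.le, hstart (c + 1) hc]
    exact hN.mono c hc
  · intro c hc k h1 h2
    rw [hstart c hc.le] at h1
    rw [hstart (c + 1) hc] at h2
    obtain ⟨k0, hk, hp⟩ := (hN.range c hc k).1 ⟨h1, h2⟩
    obtain ⟨-, -, a3, a4, a5⟩ := hN.node k k0 hk
    rw [harr' .letter (by simp)]
    rw [hp] at a3
    exact ⟨hk, a3, a4, a5⟩
  · intro k k0 hk
    obtain ⟨-, a2, -⟩ := hN.node k k0 hk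
    have hc : par k < v := by omega
    refine ⟨par k, hc, ?_⟩
    rw [hstart _ hc.le, hstart _ hc]
    exact (hN.range _ hc k).2 ⟨k0, hk, rfl⟩
  · intro x y hxy
    obtain ⟨c, -, hc, -⟩ := hcls (x, y)
    exact h.pairs.firstStep x y (by omega) hxy

theorem buildTrie_wp (hΓ : Γ.Encodes T es) (hn : s.var .n = n) (hf : s.Fresh)
    (h : AdjLists T Γ.lam (s.arr .adjHead) (s.arr .adjNext) (s.arr .adjNode) (s.arr .adjRank)
      (2 * (n - 1)) {p | T.graph.Adj p.1 p.2} D) :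
    buildTrie.wp Γ (fun s' => s'.time ≤ s.time + 1000 * (n * n) ∧ ∃ W, TrieReady Γ T s' W) s := by
  have hl := hΓ.len
  have hbd := hΓ.bound
  have hlen := hΓ.length
  have hnn : n ≤ n * n := Nat.le_mul_self n
  simp only [buildTrie, Cmd.wp_seq]
  refine makeRoot_wp hΓ hn hf h ?_
  intro s₁ hn₁ hm₁ hA₁ ho₁ ht₁ hcls₁ hhd₁ ⟨L, hL, hLm, hLl⟩
  obtain ⟨-, -, -, -, hfirst, hstart, hletter, hchild, hmark⟩ := hf
  refine ⟨by simp; omega, Cmd.loop_wp (fun k s' => ∃ v start W par Ls P, k = n * n - v ∧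
    HeadState Γ T D s' v start W par Ls P ∧
    s'.time ≤ s.time + 70 * n + 12 + 40 * v + ∑ p ∈ P, visitTime D p) (k := n * n) ?_ ?_⟩
  -- The root is the only trie node, so `start 0 = 1`, and the zeros in `child` count as outdated
  -- entries.
  · refine ⟨0, fun _ => 1, fun _ => [], fun _ => 0,
      fun c => if c = 0 then L.map fun x => (x, x) else [], ∅, rfl,
      ⟨⟨by simpa using hn₁, by simp, ?_, ?_, ?_, ?_, by simpa using ho₁, ?_⟩, by simp,
        by simp [hm₁], by simp, by simp, by simp⟩, by simp; omega⟩
    · simpa [hA₁] using h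
    · simp only [Env.tick_var, Env.set_var, ne_eq, reduceCtorEq, not_false_eq_true,
        Function.update_of_ne, hm₁, Env.tick_arr, Env.set_arr, hA₁, hletter, hchild]
      refine ⟨by omega, rfl, fun c hc c' hc' _ => by omega, fun k h0 hk => by omega,
        fun c hc => by omega, fun c _ => le_rfl, fun c hc => by omega, fun k => by omega,
        fun b => by simp, fun b hb => by simp at hb, fun k h1 h2 => by omega⟩
    · simp only [Env.tick_var, Env.set_var, ne_eq, reduceCtorEq, not_false_eq_true,
        Function.update_of_ne, hm₁, Env.tick_arr, Env.set_arr]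
      refine ⟨?_, ?_, ?_, ?_, ?_, ?_, ?_⟩
      · intro p c hc
        rw [hcls₁] at hc
        split_ifs at hc with hp
        · rw [← hp, T.natWord_self]
          exact ⟨by omega, rfl⟩
      · intro c
        by_cases hc : c = 0
        · subst hc
          simpa [Function.comp_def] using hLl
        · simpa [hc, IsLinked] using hhd₁ c hc
      · intro c
        by_cases hc : c = 0
        · simpa [hc] using hL.map fun x y hxy => (Prod.mk.inj hxy).1
        · simp [hc]
      · rintro c ⟨x, y⟩
        rw [hcls₁]
        by_cases hc : c = 0
        · by_cases hxy : x = y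
          · simp [hc, hxy, hLm]
          · simp only [hc, if_true, hxy, if_false, List.mem_map, Prod.mk.injEq]
            constructor
            · rintro ⟨a, -, rfl, rfl⟩
              exact absurd rfl hxy
            · omega
        · by_cases hxy : x = y
          · simp only [hc, if_false, hxy, if_true, List.not_mem_nil, false_iff]
            omega
          · simp [hc, hxy]
      · intro x
        simp [hcls₁]
      · intro x y z hxyz hz
        rw [hcls₁] at hz
        simp [hxyz.ne] at hz
      · intro x y hxy hne
        rw [hcls₁] at hxy
        simp [hne] at hxy
    · intro c hc
      simp [hm₁] at hc
      have : L ≠ [] := List.ne_nil_of_mem (hLm ⟨0, by omega⟩)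
      simp [hc, this]
    · simpa [hA₁] using hmark
  · rintro k s' ⟨v, start, W, par, Ls, P, rfl, hH, ht⟩
    have hvv := hH.var_v
    have hm := hH.pairs.le_mul hH.nonempty
    have hle := hH.le
    refine ⟨by simp, by simp, fun hc => ?_, fun hc => ?_⟩
    · simp [hvv] at hc
      refine Cmd.wp_mono ?_ (visitNode_wp hΓ (s := s'.tick _) (D := D) (v := v) (start := start)
        (W := W) (par := par) (Ls := Ls) (P := P) ?_ (by simpa using hc))
      · rintro s'' ⟨start', W', par', Ls', P', hH', ht'⟩
        simp at ht'
        exact ⟨_, by omega, v + 1, start', W', par', Ls', P', rfl, hH', by omega⟩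
      · obtain ⟨⟨a1, a2, a3, a4, a5, a6, a7, a8⟩, b1, b2, b3, b4, b5⟩ := hH
        exact ⟨⟨a1, a2, a3, a4, a5, a6, a7, a8⟩, b1, b2, b3, b4, b5⟩
    · simp [hvv] at hc
      have hv : s'.var .m = v := by omega
      refine ⟨by simp, by simp; omega, by simp, ?_, W, hH.ready hv rfl rfl ?_⟩
      · have h1 := sum_visitTime_le (T := T) hH.adj P
        have h2 : n * (2 * (n - 1)) ≤ 2 * (n * n) := by
          calc n * (2 * (n - 1)) ≤ n * (2 * n) := by gcongr; omega
            _ = 2 * (n * n) := by ring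
        simp
        omega
      · simp [hvv, hv]

end

end WordRAM

/-! ### Reporting the minimal absent words -/

namespace WordRAM

set_option linter.constructorNameAsVariable false

/-- Mark the letters by which the trie node `v` has children. -/
def markChildren : Cmd :=
  .set .k (.get .start (.var .v)) ;;
  .loop .lt (.var .k) (.get .start (.bin .add (.var .v) (.lit 1)))
    (.put .mark (.get .letter (.var .k)) (.var .v) ;;
      .set .k (.bin .add (.var .k) (.lit 1)))

/-- Output the path from `x` to `y` with the letter of the trie node `k`, unless it is marked. -/
def reportChild : Cmd :=
  .ite .ne (.get .mark (.get .letter (.var .k))) (.var .v)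
    (.emit (.var .x) ;; .emit (.var .y) ;; .emit (edgeLetter (.get .letter (.var .k))))
    .skip ;;
  .set .k (.bin .add (.var .k) (.lit 1))

/-- Output the path from `x` to `y` with all unmarked letters by which the trie node `c` has
children. -/
def reportChildren : Cmd :=
  .set .k (.get .start (.var .c)) ;;
  .loop .lt (.var .k) (.get .start (.bin .add (.var .c) (.lit 1))) reportChild

/-- Output the minimal absent words whose longest proper prefix belongs to the trie node `v`. -/
def reportNode : Cmd :=
  .set .p (.bin .sub (.get .head (.var .v)) (.lit 1)) ;;
  .set .x (.bin .div (.var .p) (.var .n)) ;;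
  .set .y (.bin .mod (.var .p) (.var .n)) ;;
  .set .c (.bin .sub (.get .cls (.bin .add (.bin .mul (.get .first (.var .p)) (.var .n)) (.var .y)))
    (.lit 1)) ;;
  markChildren ;;
  reportChildren ;;
  .set .v (.bin .add (.var .v) (.lit 1))

/-- Output all minimal absent words. -/
def report : Cmd :=
  .set .v (.lit 1) ;;
  .loop .lt (.var .v) (.var .m) reportNode

variable {n σ : ℕ}

/-- The words of a tree, over the natural numbers. -/
def _root_.UnrootedTree.natLanguage (T : UnrootedTree n σ) : Set (List ℕ) :=
  {z | ∃ x y, T.natWord x y = z}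

/-- The word described by two nodes and a letter, over the natural numbers. -/
noncomputable def _root_.UnrootedTree.natTriple (T : UnrootedTree n σ)
    (t : (Fin n × Fin n) × ℕ) : List ℕ :=
  T.natWord t.1.1 t.1.2 ++ [t.2]

/-- The numbers that are output for two nodes and a letter. -/
def tripleOut (t : (Fin n × Fin n) × ℕ) : List ℕ := [t.1.1, t.1.2, t.2]

/-- The word `u ++ [b]` is absent, but it is present without its first letter. -/
def _root_.UnrootedTree.IsAbsent (T : UnrootedTree n σ) (u : List ℕ) (b : ℕ) : Prop :=
  u.tail ++ [b] ∈ T.natLanguage ∧ u ++ [b] ∉ T.natLanguage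

section

variable {Γ : Ctx} {T : UnrootedTree n σ} {es : List T.graph.Dart} {Q : Env → Prop}
  {s s₀ : Env} {W : ℕ → List ℕ} {v : ℕ}

theorem TrieReady.mem_natLanguage (h : TrieReady Γ T s W) {z : List ℕ} :
    z ∈ T.natLanguage ↔ ∃ c < s.var .m, W c = z := by
  constructor
  · rintro ⟨x, y, rfl⟩
    obtain ⟨c, hc, -, hw⟩ := h.word (x, y)
    exact ⟨c, hc, hw⟩
  · rintro ⟨c, hc, rfl⟩
    obtain ⟨p, -, hp⟩ := h.head c hc
    exact ⟨p.1, p.2, hp.symm⟩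

/-- A node with a nonempty word lies in the child interval of some node; as words determine nodes,
that node must be `c`. -/
theorem TrieReady.eq_append_iff (h : TrieReady Γ T s W) {c j : ℕ} {b : ℕ} (hc : c < s.var .m)
    (hj : j < s.var .m) : W j = W c ++ [b] ↔
    s.arr .start c ≤ j ∧ j < s.arr .start (c + 1) ∧ Γ.lam (s.arr .letter j) = b := by
  constructor
  · intro e
    have hj0 : 0 < j := by
      rcases Nat.eq_zero_or_pos j with rfl | h0
      · simp [h.root] at e
      · exact h0
    obtain ⟨c', hc', h1, h2⟩ := h.cover j hj0 hj
    obtain ⟨-, hw, -⟩ := h.range c' hc' j h1 h2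
    rw [hw] at e
    obtain ⟨e1, e2⟩ := List.append_inj' e rfl
    obtain rfl := h.inj _ hc' _ hc e1
    exact ⟨h1, h2, by simpa using e2⟩
  · rintro ⟨h1, h2, rfl⟩
    exact (h.range c hc j h1 h2).2.1

theorem TrieReady.letter_injOn (h : TrieReady Γ T s W) {c : ℕ} (hc : c < s.var .m) :
    Set.InjOn (s.arr .letter) (Set.Ico (s.arr .start c) (s.arr .start (c + 1))) := by
  intro i hi j hj e
  obtain ⟨a1, a2, -⟩ := h.range c hc i hi.1 hi.2
  obtain ⟨b1, b2, -⟩ := h.range c hc j hj.1 hj.2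
  exact h.inj _ a1 _ b1 (by rw [a2, b2, e])

/-- The state during the report: only the marks and auxiliary variables have changed. -/
structure ReportState (s₀ s : Env) (v : ℕ) : Prop where
  var_n : s.var .n = s₀.var .n
  var_m : s.var .m = s₀.var .m
  var_v : s.var .v = v
  arr : ∀ A, A ≠ .mark → s.arr A = s₀.arr A

/-- The stamp is the number `v` itself. Older stamps are smaller, so the marks need no clearing
between nodes. -/
theorem markChildren_wp (hΓ : Γ.Encodes T es) (h : TrieReady Γ T s₀ W) (hs : ReportState s₀ s v)
    (hv : v < s₀.var .m) (hmark : ∀ b, s.arr .mark b < v)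
    (hQ : ∀ s' : Env, ReportState s₀ s' v → (∀ a, a ≠ .k → s'.var a = s.var a) → s'.out = s.out →
      (∀ b, s'.arr .mark b ≤ v) → (∀ b, s'.arr .mark b = v ↔
        ∃ k, s₀.arr .start v ≤ k ∧ k < s₀.arr .start (v + 1) ∧ s₀.arr .letter k = b) →
      s'.time ≤ s.time + 30 + 30 * (s₀.arr .start (v + 1) - s₀.arr .start v) → Q s') :
    markChildren.wp Γ Q s := by
  have hl := hΓ.len
  have hbd := hΓ.bound
  have hm := h.le
  have hvv := hs.var_v
  have hmono := h.mono v hv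
  have hst := hs.arr .start (by simp)
  have hle := h.start_le (v + 1) hv
  simp only [markChildren, Cmd.wp_seq, Cmd.wp_set]
  refine ⟨by simp; omega, Cmd.loop_wp (fun i s' => ∃ k, i = s₀.arr .start (v + 1) - k ∧
    s₀.arr .start v ≤ k ∧ k ≤ s₀.arr .start (v + 1) ∧ s'.var .k = k ∧ ReportState s₀ s' v ∧
    (∀ a, a ≠ .k → s'.var a = s.var a) ∧ s'.out = s.out ∧ (∀ b, s'.arr .mark b ≤ v) ∧
    (∀ b, s'.arr .mark b = v ↔ ∃ j, s₀.arr .start v ≤ j ∧ j < k ∧ s₀.arr .letter j = b) ∧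
    s'.time ≤ s.time + 10 + 30 * (k - s₀.arr .start v))
    (k := s₀.arr .start (v + 1) - s₀.arr .start v) ?_ ?_⟩
  · refine ⟨_, rfl, le_rfl, hmono, by simp [hvv, hst], ⟨by simp [hs.var_n], by simp [hs.var_m],
      by simp [hvv], by simpa using hs.arr⟩, fun a ha => by simp [ha], by simp,
      fun b => by simpa using (hmark b).le, fun b => ?_, by simp⟩
    have := (hmark b).ne
    simp only [Env.tick_arr, Env.set_arr, this, false_iff]
    rintro ⟨j, h1, h2, -⟩
    omega
  · rintro i s' ⟨k, rfl, hk1, hk2, hk, hs', hvar, hout, hle', hiff, ht⟩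
    have hst' := hs'.arr .start (by simp)
    have hlt' := hs'.arr .letter (by simp)
    have hvv' := hs'.var_v
    refine ⟨by simp, by simp; omega, fun hc => ?_, fun hc => ?_⟩
    · simp [hk, hst', hvv'] at hc
      obtain ⟨hkm, -, -, hln⟩ := h.range v hv k hk1 hc
      simp only [Cmd.wp_seq, Cmd.wp_set, Cmd.wp_put]
      refine ⟨by simp; omega, by simp [hlt', hk]; omega, by simp, by simp; omega, _, ?_, k + 1, rfl,
        by omega, by omega, by simp [hk], ⟨by simp [hs'.var_n], by simp [hs'.var_m], by simp [hvv'],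
        fun A hA => by simp [hA, hs'.arr A hA]⟩, fun a ha => by simp [ha, hvar a ha],
        by simp [hout], fun b => ?_, fun b => ?_, by simp; omega⟩
      · omega
      · simp [hk, hlt', hvv', Function.update_apply]
        split_ifs
        · exact le_rfl
        · exact hle' b
      · have : (∃ j, s₀.arr .start v ≤ j ∧ j < k + 1 ∧ s₀.arr .letter j = b) ↔
            s₀.arr .letter k = b ∨ ∃ j, s₀.arr .start v ≤ j ∧ j < k ∧ s₀.arr .letter j = b := by
          constructor
          · rintro ⟨j, h1, h2, h3⟩
            rcases Nat.lt_succ_iff_lt_or_eq.1 h2 with h2 | rfl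
            · exact Or.inr ⟨j, h1, h2, h3⟩
            · exact Or.inl h3
          · rintro (h1 | ⟨j, h1, h2, h3⟩)
            · exact ⟨k, hk1, by omega, h1⟩
            · exact ⟨j, h1, by omega, h3⟩
        rw [this, ← hiff b]
        simp only [Env.tick_arr, Env.set_arr, Env.put_arr, Expr.eval, Env.tick_var, hk, hlt', hvv',
          Function.update_self]
        by_cases e : s₀.arr .letter k = b
        · subst e; simp
        · rw [Function.update_of_ne (Ne.symm e)]
          simp [e]
    · simp [hk, hst', hvv'] at hc
      obtain rfl : k = s₀.arr .start (v + 1) := by omega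
      refine hQ _ ⟨by simp [hs'.var_n], by simp [hs'.var_m], by simp [hvv'], hs'.arr⟩
        (by simpa using hvar) (by simpa using hout) hle' hiff ?_
      simp; omega

/-- Children of `u` that are scanned without output are charged to the children of `v` with the same
letter; siblings have different letters, so no child of `v` is charged twice. -/
theorem TrieReady.card_marked_le (h : TrieReady Γ T s₀ W) {u k : ℕ} {mark : ℕ → ℕ}
    (hu : u < s₀.var .m) (hk : k ≤ s₀.arr .start (u + 1))
    (hmark : ∀ b, mark b = v ↔
      ∃ k, s₀.arr .start v ≤ k ∧ k < s₀.arr .start (v + 1) ∧ s₀.arr .letter k = b) :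
    ((Finset.Ico (s₀.arr .start u) k).filter fun j => mark (s₀.arr .letter j) = v).card ≤
      s₀.arr .start (v + 1) - s₀.arr .start v := by
  rw [← Nat.card_Ico, ← Finset.card_image_of_injOn (f := s₀.arr .letter)]
  · refine (Finset.card_le_card ?_).trans (Finset.card_image_le (f := s₀.arr .letter))
    intro b hb
    obtain ⟨j, hj, rfl⟩ := Finset.mem_image.1 hb
    obtain ⟨i, h1, h2, h3⟩ := (hmark _).1 (Finset.mem_filter.1 hj).2
    exact Finset.mem_image.2 ⟨i, Finset.mem_Ico.2 ⟨h1, h2⟩, h3⟩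
  · refine (h.letter_injOn hu).mono ?_
    intro j hj
    have := Finset.mem_Ico.1 (Finset.mem_filter.1 (Finset.mem_coe.1 hj)).1
    exact ⟨this.1, by omega⟩

/-- Children of `u` and `v` are the one-letter extensions of their words within the language. Marks
compare ranks while absence is about letters; `IsRank.inj` bridges the two. -/
theorem TrieReady.isAbsent_iff (h : TrieReady Γ T s₀ W) {u : ℕ} {mark : ℕ → ℕ}
    (hv : v < s₀.var .m) (hu : u < s₀.var .m) (hW : W u = (W v).tail)
    (hmark : ∀ b, mark b = v ↔
      ∃ k, s₀.arr .start v ≤ k ∧ k < s₀.arr .start (v + 1) ∧ s₀.arr .letter k = b) {b : ℕ} :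
    T.IsAbsent (W v) b ↔ ∃ j, s₀.arr .start u ≤ j ∧ j < s₀.arr .start (u + 1) ∧
      mark (s₀.arr .letter j) ≠ v ∧ Γ.lam (s₀.arr .letter j) = b := by
  rw [UnrootedTree.IsAbsent, ← hW, h.mem_natLanguage, h.mem_natLanguage]
  constructor
  · rintro ⟨⟨j, hj, e⟩, hno⟩
    obtain ⟨h1, h2, h3⟩ := (h.eq_append_iff hu hj).1 e
    refine ⟨j, h1, h2, fun hm => hno ?_, h3⟩
    obtain ⟨i, i1, i2, i3⟩ := (hmark _).1 hm
    have hi := (h.range v hv i i1 i2).1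
    exact ⟨i, hi, (h.eq_append_iff hv hi).2 ⟨i1, i2, by rw [i3, h3]⟩⟩
  · rintro ⟨j, h1, h2, hm, h3⟩
    obtain ⟨hj, -, hr, -⟩ := h.range u hu j h1 h2
    refine ⟨⟨j, hj, (h.eq_append_iff hu hj).2 ⟨h1, h2, h3⟩⟩, ?_⟩
    rintro ⟨i, hi, e⟩
    obtain ⟨i1, i2, i3⟩ := (h.eq_append_iff hv hi).1 e
    refine hm ((hmark _).2 ⟨i, i1, i2, ?_⟩)
    exact (h.range v hv i i1 i2).2.2.1.inj hr (i3.trans h3.symm)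

theorem reportChildren_wp (hΓ : Γ.Encodes T es) (h : TrieReady Γ T s₀ W)
    (hs : ReportState s₀ s v) (hv : v < s₀.var .m) {u : ℕ} (hu : u < s₀.var .m) {x y : Fin n}
    (hx : s.var .x = x) (hy : s.var .y = y) (hc : s.var .c = u) (hWv : W v = T.natWord x y)
    (hW : W u = (W v).tail) (hmark : ∀ b, s.arr .mark b = v ↔
      ∃ k, s₀.arr .start v ≤ k ∧ k < s₀.arr .start (v + 1) ∧ s₀.arr .letter k = b)
    {ts : List ((Fin n × Fin n) × ℕ)} (hout : s.out = ts.flatMap tripleOut)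
    (hnodup : (ts.map T.natTriple).Nodup)
    (hts : ∀ z ∈ ts.map T.natTriple, ∃ c < s₀.var .m, c ≠ v ∧ ∃ b, z = W c ++ [b])
    (hQ : ∀ (s' : Env) (ts' : List ((Fin n × Fin n) × ℕ)), ReportState s₀ s' v →
      s'.arr .mark = s.arr .mark → s'.out = (ts ++ ts').flatMap tripleOut →
      ((ts ++ ts').map T.natTriple).Nodup →
      (∀ z, z ∈ ts'.map T.natTriple ↔ ∃ b, z = W v ++ [b] ∧ T.IsAbsent (W v) b) →
      s'.time ≤ s.time + 30 + 100 * ts'.length +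
        60 * (s₀.arr .start (v + 1) - s₀.arr .start v) → Q s') :
    reportChildren.wp Γ Q s := by
  have hl := hΓ.len
  have hbd := hΓ.bound
  have hbase := hΓ.base
  have hm := h.le
  have hvv := hs.var_v
  have hmono := h.mono u hu
  have hst := hs.arr .start (by simp)
  have hle := h.start_le (u + 1) hu
  simp only [reportChildren, Cmd.wp_seq, Cmd.wp_set]
  refine ⟨by simp; omega, Cmd.loop_wp (fun i s' => ∃ k ts', i = s₀.arr .start (u + 1) - k ∧
    s₀.arr .start u ≤ k ∧ k ≤ s₀.arr .start (u + 1) ∧ s'.var .k = k ∧ ReportState s₀ s' v ∧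
    (∀ a, a ≠ .k → s'.var a = s.var a) ∧ s'.arr .mark = s.arr .mark ∧
    s'.out = (ts ++ ts').flatMap tripleOut ∧ ((ts ++ ts').map T.natTriple).Nodup ∧
    (∀ z, z ∈ ts'.map T.natTriple ↔ ∃ j, s₀.arr .start u ≤ j ∧ j < k ∧
      s.arr .mark (s₀.arr .letter j) ≠ v ∧ z = W v ++ [Γ.lam (s₀.arr .letter j)]) ∧
    s'.time ≤ s.time + 10 + 100 * ts'.length + 60 * ((Finset.Ico (s₀.arr .start u) k).filter
      fun j => s.arr .mark (s₀.arr .letter j) = v).card)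
    (k := s₀.arr .start (u + 1) - s₀.arr .start u) ?_ ?_⟩
  · refine ⟨_, [], rfl, le_rfl, hmono, by simp [hc, hst], ⟨by simp [hs.var_n], by simp [hs.var_m],
      by simp [hvv], by simpa using hs.arr⟩, fun a ha => by simp [ha], by simp, by simp [hout],
      by simpa using hnodup, fun z => ?_, by simp⟩
    simp only [List.map_nil, List.not_mem_nil, false_iff]
    rintro ⟨j, h1, h2, -⟩
    omega
  · rintro i s' ⟨k, ts', rfl, hk1, hk2, hk, hs', hvar, hmk, hout', hnd, hmem, ht⟩
    have hst' := hs'.arr .start (by simp)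
    have hlt' := hs'.arr .letter (by simp)
    have hvv' := hs'.var_v
    have hc' : s'.var .c = u := by rw [hvar _ (by simp), hc]
    refine ⟨by simp, by simp [hc']; omega, fun hc => ?_, fun hc => ?_⟩
    · simp [hk, hst', hc'] at hc
      obtain ⟨hkm, hWk, hrk, hln⟩ := h.range u hu k hk1 hc
      have hico : Finset.Ico (s₀.arr .start u) (k + 1) =
          insert k (Finset.Ico (s₀.arr .start u) k) := by
        ext j
        simp only [Finset.mem_Ico, Finset.mem_insert]
        omega
      have hlast : ∀ z, (∃ j, s₀.arr .start u ≤ j ∧ j < k + 1 ∧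
          s.arr .mark (s₀.arr .letter j) ≠ v ∧ z = W v ++ [Γ.lam (s₀.arr .letter j)]) ↔
          z ∈ ts'.map T.natTriple ∨ (s.arr .mark (s₀.arr .letter k) ≠ v ∧
            z = W v ++ [Γ.lam (s₀.arr .letter k)]) := by
        intro z
        rw [hmem]
        constructor
        · rintro ⟨j, h1, h2, h3⟩
          rcases Nat.lt_succ_iff_lt_or_eq.1 h2 with h2 | rfl
          · exact Or.inl ⟨j, h1, h2, h3⟩
          · exact Or.inr h3
        · rintro (⟨j, h1, h2, h3⟩ | h1)
          · exact ⟨j, h1, by omega, h3⟩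
          · exact ⟨k, hk1, by omega, h1⟩
      simp only [reportChild, Cmd.wp]
      refine ⟨by simp [hk, hlt']; omega, by simp, fun hc2 => ?_, fun hc2 => ?_⟩
      · simp [hk, hlt', hvv', hmk] at hc2
        have e1 : s'.var .x = x := by rw [hvar _ (by simp), hx]
        have e2 : s'.var .y = y := by rw [hvar _ (by simp), hy]
        have hnat : T.natTriple ((x, y), Γ.lam (s₀.arr .letter k)) =
            W v ++ [Γ.lam (s₀.arr .letter k)] := by rw [UnrootedTree.natTriple, hWv]
        refine ⟨by simp, by simp, by simp [edgeLetter, hk, hlt']; omega, by simp [hk]; omega,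
          _, ?_, k + 1, ts' ++ [((x, y), Γ.lam (s₀.arr .letter k))], rfl, by omega, by omega,
          by simp [hk], ⟨by simp [hs'.var_n], by simp [hs'.var_m], by simp [hvv'], hs'.arr⟩,
          fun a ha => by simp [ha, hvar a ha], hmk, ?_, ?_, fun z => ?_, ?_⟩
        · omega
        · simp [hout', tripleOut, e1, e2, edgeLetter, hk, hlt', Ctx.lam]
        -- A repeated word would have been output at another trie node, whose prefix differs, or at
        -- this one with the same letter, hence at the same child of `u`.
        · rw [← List.append_assoc, List.map_append, List.nodup_append]
          refine ⟨hnd, by simp, fun z hz z' hz' => ?_⟩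
          rw [List.map_singleton, List.mem_singleton] at hz'
          rw [hz', hnat]
          rintro rfl
          rw [List.map_append, List.mem_append] at hz
          rcases hz with hz | hz
          · obtain ⟨c, hcm, hcv, b, e⟩ := hts _ hz
            exact hcv (h.inj _ hcm _ hv (List.append_inj' e rfl).1.symm)
          · obtain ⟨j, j1, j2, -, e⟩ := (hmem _).1 hz
            have e' : Γ.lam (s₀.arr .letter k) = Γ.lam (s₀.arr .letter j) := by
              simpa using (List.append_inj' e rfl).2
            obtain ⟨hjm, hWj, -⟩ := h.range u hu j j1 (by omega)
            have := h.inj _ hjm _ hkm (by rw [hWj, hWk, e'])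
            omega
        · rw [hlast, List.map_append, List.mem_append, List.map_singleton, List.mem_singleton, hnat]
          simp [hc2]
        · rw [hico, Finset.filter_insert, if_neg hc2]
          simp [edgeLetter]
          omega
      · simp [hk, hlt', hvv', hmk] at hc2
        refine ⟨by simp [hk]; omega, _, ?_, k + 1, ts', rfl, by omega, by omega,
          by simp [hk], ⟨by simp [hs'.var_n], by simp [hs'.var_m], by simp [hvv'], hs'.arr⟩,
          fun a ha => by simp [ha, hvar a ha], hmk, hout', hnd, fun z => ?_, ?_⟩
        · omega
        · rw [hlast]
          simp [hc2]
        · rw [hico, Finset.filter_insert, if_pos hc2, Finset.card_insert_of_notMem (by simp)]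
          simp
          omega
    · simp [hk, hst', hc'] at hc
      obtain rfl : k = s₀.arr .start (u + 1) := by omega
      refine hQ _ ts' ⟨by simp [hs'.var_n], by simp [hs'.var_m], by simp [hvv'], hs'.arr⟩ hmk hout'
        hnd (fun z => ?_) ?_
      · rw [hmem]
        constructor
        · rintro ⟨j, h1, h2, h3, rfl⟩
          exact ⟨_, rfl, (h.isAbsent_iff hv hu hW hmark).2 ⟨j, h1, h2, h3, rfl⟩⟩
        · rintro ⟨b, rfl, hb⟩
          obtain ⟨j, h1, h2, h3, h4⟩ := (h.isAbsent_iff hv hu hW hmark).1 hb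
          exact ⟨j, h1, h2, h3, by rw [h4]⟩
      · have := h.card_marked_le hu le_rfl hmark
        simp
        omega

/-- The triples in `ts` have been output; they describe the minimal absent words whose longest
proper prefixes belong to trie nodes before `v`. -/
structure Reported (T : UnrootedTree n σ) (W : ℕ → List ℕ) (s₀ s : Env) (v : ℕ)
    (ts : List ((Fin n × Fin n) × ℕ)) : Prop extends ReportState s₀ s v where
  mark : ∀ b, s.arr .mark b < v
  out : s.out = ts.flatMap tripleOut
  nodup : (ts.map T.natTriple).Nodup
  mem : ∀ z, z ∈ ts.map T.natTriple ↔
    ∃ c, 0 < c ∧ c < v ∧ ∃ b, z = W c ++ [b] ∧ T.IsAbsent (W c) b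

/-- Since `v` is not the root, its representative path from `x` to `y` has a first step `f`, and the
class of `(f, y)` is the node for the word without its first letter. -/
theorem reportNode_wp (hΓ : Γ.Encodes T es) (h : TrieReady Γ T s₀ W)
    {ts : List ((Fin n × Fin n) × ℕ)} (hs : Reported T W s₀ s v ts) (hv0 : 0 < v)
    (hv : v < s₀.var .m) :
    reportNode.wp Γ (fun s' => ∃ ts', Reported T W s₀ s' (v + 1) (ts ++ ts') ∧
      s'.time ≤ s.time + 150 + 100 * ts'.length +
        90 * (s₀.arr .start (v + 1) - s₀.arr .start v)) s := by
  have hl := hΓ.len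
  have hbd := hΓ.bound
  have hm := h.le
  have hvv := hs.var_v
  have hn : s.var .n = n := by rw [hs.var_n, h.var_n]
  have hhd := hs.arr .head (by simp)
  have hcl := hs.arr .cls (by simp)
  have hfi := hs.arr .first (by simp)
  obtain ⟨⟨x, y⟩, hp, hWv⟩ := h.head v hv
  have hxy : x ≠ y := by
    rintro rfl
    rw [T.natWord_self, ← h.root] at hWv
    have := h.inj _ hv _ h.pos hWv
    omega
  obtain ⟨f, hf, hfs⟩ := h.first x y hxy
  obtain ⟨u, hu, hcu, hWu⟩ := h.word (f, y)
  have hp' : s₀.arr .head v - 1 = pairIdx (x, y) := by rw [hp]; rfl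
  have hlt := pairIdx_lt (x, y)
  have hlt' := pairIdx_lt (f, y)
  have hfy : (f : ℕ) * n + y = pairIdx (f, y) := rfl
  have hu' : s₀.arr .cls (pairIdx (f, y)) - 1 = u := by rw [hcu]; rfl
  have hdiv : pairIdx (x, y) / n = x := pairIdx_div _
  have hmod : pairIdx (x, y) % n = y := pairIdx_mod _
  simp only [reportNode, Cmd.wp_seq, Cmd.wp_set]
  simp only [Expr.eval, Env.tick_var, Env.set_var, NatOp.eval, Env.tick_set, Env.tick_tick,
    Function.update_self, ne_eq, reduceCtorEq, not_false_eq_true, Function.update_of_ne,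
    Env.tick_arr, Env.set_arr, hvv, hhd, hcl, hfi, hp', hn, hdiv, hmod, hf, hfy, hu']
  refine ⟨?_, by simp, by simp, ?_, ?_⟩
  · simp [hvv, hhd, hp]
    omega
  · simp [hcl, hfi, hn, hf, hfy, hcu]
    have : (f : ℕ) * n ≤ pairIdx (f, y) := Nat.le_add_right _ _
    omega
  refine markChildren_wp hΓ h ⟨by simp [hs.var_n], by simp [hs.var_m], by simp [hvv],
    by simpa using hs.arr⟩ hv (by simpa using hs.mark) ?_
  intro s₁ hs₁ hvar₁ hout₁ hle₁ hmark₁ ht₁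
  refine reportChildren_wp hΓ h hs₁ hv hu (x := x) (y := y) (by simp [hvar₁]) (by simp [hvar₁])
    (by simp [hvar₁]) hWv (by rw [hWu, hWv, hfs.natWord]; rfl) hmark₁ (ts := ts)
    (by simpa [hout₁] using hs.out) hs.nodup ?_ ?_
  · intro z hz
    obtain ⟨c, -, hcv, b, e, -⟩ := (hs.mem z).1 hz
    exact ⟨c, by omega, by omega, b, e⟩
  · intro s₂ ts' hs₂ hmk₂ hout₂ hnd₂ hmem₂ ht₂
    have hvv₂ := hs₂.var_v
    refine ⟨by simp; omega, ts', ⟨⟨by simp [hs₂.var_n], by simp [hs₂.var_m], by simp [hvv₂],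
      hs₂.arr⟩, fun b => ?_, hout₂, hnd₂, fun z => ?_⟩, ?_⟩
    · have := hle₁ b
      simp only [Env.tick_arr, Env.set_arr, hmk₂]
      omega
    · rw [List.map_append, List.mem_append, hs.mem, hmem₂]
      constructor
      · rintro (⟨c, h1, h2, h3⟩ | h1)
        · exact ⟨c, h1, by omega, h3⟩
        · exact ⟨v, hv0, by omega, h1⟩
      · rintro ⟨c, h1, h2, h3⟩
        rcases Nat.lt_succ_iff_lt_or_eq.1 h2 with h2 | rfl
        · exact Or.inl ⟨c, h1, h2, h3⟩
        · exact Or.inr h3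
    · simp at ht₁ ht₂ ⊢
      omega

theorem report_wp (hΓ : Γ.Encodes T es) (h : TrieReady Γ T s W) :
    report.wp Γ (fun s' => ∃ ts : List ((Fin n × Fin n) × ℕ), s'.out = ts.flatMap tripleOut ∧
      (ts.map T.natTriple).Nodup ∧ (∀ z, z ∈ ts.map T.natTriple ↔
        ∃ u b, z = u ++ [b] ∧ u ≠ [] ∧ u ∈ T.natLanguage ∧ T.IsAbsent u b) ∧
      s'.time ≤ s.time + 400 * (n * n) + 100 * ts.length) s := by
  have hl := hΓ.len
  have hbd := hΓ.bound
  have hm := h.le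
  have hpos := h.pos
  simp only [report, Cmd.wp_seq, Cmd.wp_set]
  refine ⟨by simp; omega, Cmd.loop_wp (fun k s' => ∃ v ts, k = s.var .m - v ∧ 0 < v ∧
    v ≤ s.var .m ∧ Reported T W s s' v ts ∧
    -- The terms `start (v + 1) - start v` of the single nodes telescope to `start v`; 153 adds the
    -- 3 steps of the loop test to the fixed cost 150.
    s'.time ≤ s.time + 2 + 153 * v + 100 * ts.length + 90 * s.arr .start v)
    (k := s.var .m - 1) ?_ ?_⟩
  · refine ⟨1, [], rfl, by omega, by omega, ⟨⟨by simp, by simp, by simp, by simp⟩,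
      by simp [h.mark], by simp [h.out], by simp, fun z => ?_⟩, by simp; omega⟩
    simp only [List.map_nil, List.not_mem_nil, false_iff]
    rintro ⟨c, h1, h2, -⟩
    omega
  · rintro k s' ⟨v, ts, rfl, hv0, hvm, hR, ht⟩
    have hvv := hR.var_v
    have hmm := hR.var_m
    refine ⟨by simp, by simp, fun hc => ?_, fun hc => ?_⟩
    · simp [hvv, hmm] at hc
      refine Cmd.wp_mono ?_ (reportNode_wp hΓ h (s := s'.tick _) (ts := ts) ?_ hv0 hc)
      · rintro s'' ⟨ts', hR', ht'⟩
        have hmono := h.mono v hc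
        refine ⟨_, ?_, v + 1, ts ++ ts', rfl, by omega, by omega, hR', ?_⟩
        · omega
        · simp at ht' ⊢
          omega
      · obtain ⟨⟨a1, a2, a3, a4⟩, b1, b2, b3, b4⟩ := hR
        exact ⟨⟨a1, a2, a3, a4⟩, b1, b2, b3, b4⟩
    · simp [hvv, hmm] at hc
      obtain rfl : v = s.var .m := by omega
      have hst := h.start_le _ le_rfl
      refine ⟨ts, hR.out, hR.nodup, fun z => ?_, by simp; omega⟩
      rw [hR.mem]
      constructor
      · rintro ⟨c, h1, h2, b, rfl, hb⟩
        refine ⟨W c, b, rfl, fun e => ?_, h.mem_natLanguage.2 ⟨c, h2, rfl⟩, hb⟩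
        rw [← h.root] at e
        have := h.inj _ h2 _ h.pos e
        omega
      · rintro ⟨u, b, rfl, hu, hmem, hb⟩
        obtain ⟨c, hc, rfl⟩ := h.mem_natLanguage.1 hmem
        refine ⟨c, Nat.pos_of_ne_zero fun e => hu ?_, hc, b, rfl, hb⟩
        rw [e, h.root]

end

end WordRAM

/-! ### The algorithm -/

namespace WordRAM

/-- Compute the minimal absent words of a tree. -/
def solve : Cmd := buildAdjacency ;; buildTrie ;; report

/-- Compute the length of the input. -/
def prologue : Prog :=
  .seq (.const 1 0) (.seq (.load 1 1) (.seq (.const 3 3) (.op .mul 1 1 3)))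

variable {n σ : ℕ} {T : UnrootedTree n σ} {es : List T.graph.Dart}

/-- The constant data that belong to an input. -/
def inputCtx (n : ℕ) (input : List ℕ) : Ctx where
  inp i := input.getD i 0
  base := 3 * n
  len := n * n + 2 * n + 1
  bound := n * n + 3 * n + 20

theorem getD_flatMap_three {α : Type*} (a b c : α → ℕ) (l : List α) (i : ℕ) (hi : i < l.length) :
    (l.flatMap fun d => [a d, b d, c d]).getD (3 * i) 0 = a l[i] ∧
    (l.flatMap fun d => [a d, b d, c d]).getD (3 * i + 1) 0 = b l[i] ∧
    (l.flatMap fun d => [a d, b d, c d]).getD (3 * i + 2) 0 = c l[i] := by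
  induction l generalizing i with
  | nil => simp at hi
  | cons d l ih =>
    cases i with
    | zero => simp
    | succ i =>
      have := ih i (by simpa using hi)
      simpa [List.flatMap_cons, mul_add] using this

theorem _root_.UnrootedTree.IsEdgeList.length (h : T.IsEdgeList es) : es.length + 1 = n := by
  classical
  have h1 : (es.map SimpleGraph.Dart.edge).toFinset = T.graph.edgeFinset := by
    ext e
    rw [List.mem_toFinset, SimpleGraph.mem_edgeFinset]
    refine ⟨fun he => ?_, h.2 e⟩
    obtain ⟨d, -, rfl⟩ := List.mem_map.1 he
    exact d.edge_mem
  have h2 := T.isTree.card_edgeFinset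
  rw [← h1, List.toFinset_card_of_nodup h.1, List.length_map, Fintype.card_fin] at h2
  exact h2

theorem _root_.UnrootedTree.IsEdgeList.adj_subset (h : T.IsEdgeList es) :
    {p : Fin n × Fin n | T.graph.Adj p.1 p.2} ⊆ edgePairs es es.length := by
  intro p hp
  obtain ⟨d, hd, e⟩ := List.mem_map.1 (h.2 s(p.1, p.2) hp)
  obtain ⟨j, hj, rfl⟩ := List.getElem_of_mem hd
  refine ⟨j, hj, hj, ?_⟩
  rcases SimpleGraph.dart_edge_eq_mk'_iff.1 e with e | e
  · exact Or.inl e.symm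
  · right
    rw [e]

theorem inputCtx_encodes (h : T.IsEdgeList es) :
    (inputCtx n (T.encode es)).Encodes T es := by
  have key := getD_flatMap_three (fun d : T.graph.Dart => (d.fst : ℕ)) (fun d => (d.snd : ℕ))
    (fun d => (T.label ⟨d.edge, d.edge_mem⟩ : ℕ)) es
  refine ⟨h.length, rfl, fun i hi => ?_, fun i hi => ?_, fun i hi => ?_, rfl, rfl, rfl⟩
  · exact (key i hi).1
  · exact (key i hi).2.1
  · rw [T.natLabel_of_adj es[i].adj]
    exact (key i hi).2.2

/-- The coefficients of `q` sum to `q.eval 1`, whence $q(n)\le q(1)\,n^{\deg q}$. With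
$q(1)<2^{q(1)L}$ this shows that letters fit into a word of length proportional to $\log n$. -/
theorem eval_lt_two_pow (q : Polynomial ℕ) {n L : ℕ} (hn : n < 2 ^ L) (hL : 0 < L) (h0 : 0 < n) :
    q.eval n < 2 ^ ((q.eval 1 + q.natDegree) * L) := by
  have h1 : q.eval n ≤ q.eval 1 * n ^ q.natDegree := by
    rw [Polynomial.eval_eq_sum_range, Polynomial.eval_eq_sum_range, Finset.sum_mul]
    refine Finset.sum_le_sum fun i hi => ?_
    rw [one_pow, mul_one]
    exact Nat.mul_le_mul_left _ (Nat.pow_le_pow_right h0 (by simpa [Nat.lt_succ_iff] using hi))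
  have h2 : q.eval 1 < 2 ^ (q.eval 1 * L) :=
    Nat.lt_two_pow_self.trans_le (Nat.pow_le_pow_right (by omega) (Nat.le_mul_of_pos_right _ hL))
  calc q.eval n ≤ q.eval 1 * n ^ q.natDegree := h1
    _ ≤ q.eval 1 * (2 ^ L) ^ q.natDegree := by gcongr
    _ < 2 ^ (q.eval 1 * L) * (2 ^ L) ^ q.natDegree := by
      exact Nat.mul_lt_mul_of_pos_right h2 (by positivity)
    _ = 2 ^ ((q.eval 1 + q.natDegree) * L) := by
      rw [← pow_mul, ← pow_add]
      ring_nf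

/-- The input occupies $3n-2$ cells, so an array region from `3 * n` on is initially zero. The time
4 in the represented state accounts for the prologue itself. -/
theorem prologue_exec {w S : ℕ} (h : T.IsEdgeList es) (hS : 0 < S) (h3 : 3 * n < 2 ^ w)
    (hlt : ∀ a ∈ T.encode es, a < 2 ^ w) :
    ∃ σ' : State w, Exec S prologue (State.init w (T.encode es)) 4 σ' ∧
      Rep (inputCtx n (T.encode es)) σ' ⟨0, 0, [], 4⟩ := by
  have hlt' : ∀ i, (T.encode es).getD i 0 < 2 ^ w := by
    intro i
    rw [List.getD_eq_getElem?_getD]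
    by_cases hi : i < (T.encode es).length
    · simpa [hi] using hlt _ (List.getElem_mem hi)
    · simp [hi]
  have hlen : (T.encode es).length ≤ 3 * n := by
    have := h.length
    simp [UnrootedTree.encode, List.length_flatMap]
    omega
  refine ⟨_, .seq (t₁ := 1) (t₂ := 3) (.const _ _ _) (.seq (t₁ := 1) (t₂ := 2) (.load _ _ _ ?_)
    (.seq (t₁ := 1) (t₂ := 1) (.const _ _ _) (.op _ _ _ _ _))), ?_, ?_, ?_, ?_, ?_⟩
  · simpa using hS
  · have h0 : (T.encode es)[0]?.getD 0 = n := by simp [UnrootedTree.encode]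
    simp [Op.eval, State.init, inputCtx, h0]
    rw [mul_comm n 3, Nat.mod_eq_of_lt h3]
  · intro a
    have h1 : 2 * a.idx ≠ 1 := by omega
    have h2 : 2 * a.idx ≠ 3 := by omega
    simp [State.init, h1, h2]
  · intro i _
    simp only [State.init, inputCtx, BitVec.toNat_ofNat]
    exact Nat.mod_eq_of_lt (hlt' i)
  · intro A i _
    have : (T.encode es).length ≤ 16 * i + A.idx + 3 * n := by omega
    simp [State.init, inputCtx, this]
  · simp [State.init]

theorem solve_wp (h : T.IsEdgeList es) :
    solve.wp (inputCtx n (T.encode es)) (fun s' => ∃ ts : List ((Fin n × Fin n) × ℕ),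
      s'.out = ts.flatMap tripleOut ∧ (ts.map T.natTriple).Nodup ∧
      (∀ z, z ∈ ts.map T.natTriple ↔
        ∃ u b, z = u ++ [b] ∧ u ≠ [] ∧ u ∈ T.natLanguage ∧ T.IsAbsent u b) ∧
      s'.time ≤ 4 + 1700 * (n * n) + 100 * ts.length) ⟨0, 0, [], 4⟩ := by
  have hΓ := inputCtx_encodes h
  have hlen := h.length
  simp only [solve, Cmd.wp_seq]
  refine Cmd.wp_mono ?_ (buildAdjacency_wp hΓ (fun _ => rfl) rfl)
  rintro s₁ ⟨hn, hf, ht, D, hD⟩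
  rw [show es.length = n - 1 by omega] at hD
  rw [Cmd.wp_seq]
  refine Cmd.wp_mono ?_ (buildTrie_wp hΓ hn hf (D := D) (hD.mono ?_))
  · rintro s₂ ⟨ht₂, W, hW⟩
    refine Cmd.wp_mono ?_ (report_wp hΓ hW)
    rintro s₃ ⟨ts, h1, h2, h3, h4⟩
    refine ⟨ts, h1, h2, h3, ?_⟩
    simp only at ht
    omega
  · rw [show n - 1 = es.length by omega]
    exact h.adj_subset

theorem _root_.UnrootedTree.mem_maw_iff {z : List (Fin σ)} :
    z ∈ T.maw ↔ ∃ u b, z.map Fin.val = u ++ [b] ∧ u ≠ [] ∧ u ∈ T.natLanguage ∧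
      T.IsAbsent u b := by
  have hmem : ∀ {z : List (Fin σ)}, z ∈ T.language ↔ z.map Fin.val ∈ T.natLanguage :=
    T.map_val_mem_iff
  constructor
  · rintro ⟨a, u, b, rfl, h1, h2, h3⟩
    refine ⟨(a :: u).map Fin.val, b, by simp, by simp, hmem.1 h2, ?_, ?_⟩
    · simpa using hmem.1 h3
    · simpa using mt hmem.2 h1
  · rintro ⟨u, b, e, hu, h1, h2, h3⟩
    obtain ⟨z₁, z₂, rfl, rfl, hb⟩ := List.map_eq_append_iff.1 e
    obtain ⟨b, rfl, rfl⟩ : ∃ b', z₂ = [b'] ∧ b'.val = b := by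
      simpa [List.map_eq_cons_iff] using hb
    obtain _ | ⟨a, u⟩ := z₁
    · simp at hu
    refine ⟨a, u, b, rfl, fun h => h3 ?_, hmem.2 h1, hmem.2 ?_⟩
    · simpa using hmem.1 h
    · simpa using h2

/-- The program handles letters as plain numbers. A reported `b` ends a word of the language, so it
is the label of an edge and lifts to `Fin σ`; distinctness of the words then gives the count. -/
theorem listsMAW_of_triples {w : ℕ} {ts : List ((Fin n × Fin n) × ℕ)}
    (hnodup : (ts.map T.natTriple).Nodup) (hmem : ∀ z, z ∈ ts.map T.natTriple ↔
      ∃ u b, z = u ++ [b] ∧ u ≠ [] ∧ u ∈ T.natLanguage ∧ T.IsAbsent u b) :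
    T.ListsMAW ((ts.flatMap tripleOut).map (BitVec.ofNat w)) ∧ ts.length = T.maw.ncard := by
  classical
  let g : Fin n × Fin n × Fin σ → (Fin n × Fin n) × ℕ := fun t => ((t.1, t.2.1), t.2.2.val)
  obtain ⟨ts, rfl⟩ : ts ∈ Set.range (List.map g) := by
    rw [Set.range_list_map]
    intro t ht
    obtain ⟨u, b, e, -, -, ⟨x, y, hxy⟩, -⟩ := (hmem _).1 (List.mem_map_of_mem ht)
    have hb : t.2 = b := by simpa using (List.append_inj' e rfl).2
    have hb' : b ∈ T.natWord x y := by rw [hxy]; simp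
    obtain ⟨c, -, hc⟩ := List.mem_map.1 hb'
    exact ⟨(t.1.1, t.1.2, c), by simp only [g, hc, ← hb]⟩
  have hg : (ts.map g).map T.natTriple = (ts.map T.tripleWord).map (List.map Fin.val) := by
    rw [List.map_map, List.map_map]
    refine List.map_congr_left fun t _ => ?_
    simp [g, UnrootedTree.natTriple, UnrootedTree.tripleWord, UnrootedTree.natWord]
  rw [hg] at hnodup
  have hnd := hnodup.of_map
  have hmaw : ∀ z, z ∈ ts.map T.tripleWord ↔ z ∈ T.maw := by
    intro z
    rw [T.mem_maw_iff, ← List.mem_map_of_injective (List.map_injective_iff.2 Fin.val_injective),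
      ← hg, hmem]
  refine ⟨⟨ts, ?_, hnd, hmaw⟩, ?_⟩
  · rw [List.map_flatMap, List.flatMap_map]
    rfl
  · have : T.maw = ((ts.map T.tripleWord).toFinset : Set (List (Fin σ))) := by
      ext z
      rw [← hmaw]
      simp
    rw [this, Set.ncard_coe_finset, List.toFinset_card_of_nodup hnd]
    simp

end WordRAM

theorem mainTheorem6 :
    ∃ P : WordRAM.Prog, ∀ q : Polynomial ℕ, ∃ C : ℕ,
      ∀ (n σ : ℕ) (T : UnrootedTree n σ), σ ≤ q.eval n →
      ∀ es : List T.graph.Dart, T.IsEdgeList es →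
      ∀ w : ℕ, C * (Nat.log 2 n + 1) ≤ w →
        ∃ (S t : ℕ) (s : WordRAM.State w),
          WordRAM.Exec S P (WordRAM.State.init w (T.encode es)) t s ∧
          t ≤ C * (n ^ 2 + T.maw.ncard) ∧
          S ≤ C * n ^ 2 ∧
          T.ListsMAW s.out := by
  open WordRAM in
  -- The summand `q.eval 1 + q.natDegree` provides room for the letters; 2000 covers the constants
  -- for time, space and addresses.
  refine ⟨.seq prologue solve.code, fun q => ⟨q.eval 1 + q.natDegree + 2000, ?_⟩⟩
  intro n σ T hσ es hes w hw
  have hn : 0 < n := by have := hes.length; omega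
  have hnn : n ≤ n * n := Nat.le_mul_self n
  have hC : 2000 ≤ q.eval 1 + q.natDegree + 2000 := Nat.le_add_left _ _
  have hlog : n < 2 ^ (Nat.log 2 n + 1) := Nat.lt_pow_succ_log_self (by omega) n
  have hσw : σ < 2 ^ w := by
    refine (hσ.trans_lt (eval_lt_two_pow q hlog (by omega) hn)).trans_le
      (Nat.pow_le_pow_right (by omega) (le_trans ?_ hw))
    exact Nat.mul_le_mul_right _ (by omega)
  have hbig : 100 * (n * n) < 2 ^ w := by
    -- All addresses and arithmetic results are below $100n^2$, for which $7+1+1=9$ times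
    -- $\lfloor\log_2 n\rfloor+1$ bits suffice.
    calc 100 * (n * n) < 2 ^ 7 * (n * n) := by nlinarith
      _ ≤ 2 ^ (7 * (Nat.log 2 n + 1)) * (2 ^ (Nat.log 2 n + 1) * 2 ^ (Nat.log 2 n + 1)) := by
        gcongr <;> omega
      _ = 2 ^ (9 * (Nat.log 2 n + 1)) := by
        rw [← pow_add, ← pow_add]
        ring_nf
      _ ≤ 2 ^ w := by
        refine Nat.pow_le_pow_right (by omega) (le_trans ?_ hw)
        exact Nat.mul_le_mul_right _ (by omega)
  have hlt : ∀ a ∈ T.encode es, a < 2 ^ w := by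
    intro a ha
    rcases List.mem_cons.1 ha with rfl | ha
    · omega
    · obtain ⟨d, -, hd⟩ := List.mem_flatMap.1 ha
      have h1 := d.fst.isLt
      have h2 := d.snd.isLt
      have h3 := (T.label ⟨d.edge, d.edge_mem⟩).isLt
      simp only [List.mem_cons, List.not_mem_nil, or_false] at hd
      omega
  have hfits : (inputCtx n (T.encode es)).Fits w := by
    refine ⟨?_, ?_⟩ <;> simp only [inputCtx] <;> omega
  obtain ⟨σ₁, e₁, r₁⟩ := prologue_exec (w := w)
    (S := (inputCtx n (T.encode es)).base + 16 * (inputCtx n (T.encode es)).len) hes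
    (by simp only [inputCtx]; omega) (by omega) hlt
  obtain ⟨t, σ₂, s₂, e₂, r₂, ht, ts, hout, hnodup, hmem, htime⟩ :=
    Cmd.code_exec hfits solve r₁ (solve_wp hes)
  obtain ⟨hmaw, hcard⟩ := listsMAW_of_triples (w := w) hnodup hmem
  refine ⟨_, _, σ₂, .seq e₁ e₂, ?_, ?_, by rw [r₂.out, hout]; exact hmaw⟩
  · rw [← hcard, pow_two]
    simp only at ht
    calc 4 + t ≤ 2000 * (n * n + ts.length) := by omega
      _ ≤ _ := Nat.mul_le_mul_right _ hC
  · rw [pow_two]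
    simp only [inputCtx]
    calc 3 * n + 16 * (n * n + 2 * n + 1) ≤ 2000 * (n * n) := by omega
      _ ≤ _ := Nat.mul_le_mul_right _ hC
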